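/- Let $d\ge 1$, $\alpha\in(0,2)$, $\gamma\in[1,d]$, and let $S=\{x\in\mathbb R^d:|x|=1\}$. Let $\mu$ be a finite Borel measure on $S$ which is nondegenerate (its support is not contained in any proper linear subspace of $\mathbb R^d$) and is a $(\gamma-1)$-measure on $S$: for some constant $C$, $\mu(S\cap B(\theta,\rho))\le C\rho^{\gamma-1}$ for all $\theta\in S$, $\rho>0$. If $\alpha=1$, assume in addition that $\int_S\theta\,\mu(d\theta)=0$. Let $$\nu(A)=\int_0^\infty\int_S \mathbf 1_A(s\theta)\,\mu(d\theta)\,s^{-1-\alpha}\,ds,\qquad A\subset\mathbb R^d \text{ Borel},$$ let $b=\int_{|y|<1}y\,\nu(dy)$ if $\alpha<1$, $b=0$ if $\alpha=1$, $b=-\int_{|y|>1}y\,\nu(dy)$ if $\alpha>1$, and let $\{P_t\}_{t\ge0}$ be the $\alpha$-stable semigroup with spectral measure $\mu$, that is, the convolution semigroup of probability measures on $\mathbb R^d$ with $\int e^{i\langle\xi,y\rangle}P_t(dy)=e^{-t\Phi(\xi)}$, where $$\Phi(\xi)=-\int\left(e^{i\langle\xi,y\rangle}-1-i\langle\xi,y\rangle\mathbf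 1_{B(0,1)}(y)\right)\nu(dy)-i\langle\xi,b\rangle .$$ Then for every $t>0$ the measure $P_t$ has a continuous density $p_t\ge0$ with respect to Lebesgue measure, and there is a constant $c>0$, depending only on $d,\alpha,\gamma,\mu$, such that $$p_t(x)\le c\,t^{-d/\alpha}\min\left\{1,\;t^{1+\gamma/\alpha}|x|^{-\gamma-\alpha}\right\},\qquad t>0,\ x\in\mathbb R^d,$$ where for $x=0$ the minimum is understood to be $1$. -/

import Mathlib

open MeasureTheory
open scoped NNReal

noncomputable section

/-- A measure on `ℝ^d` is nondegenerate if its (topological) support is not contained in any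
proper linear subspace. -/
def IsNondegenerate {d : ℕ} (m : Measure (EuclideanSpace ℝ (Fin d))) : Prop :=
  ¬ ∃ M : Submodule ℝ (EuclideanSpace ℝ (Fin d)), M ≠ ⊤ ∧ m.support ⊆ (M : Set _)

/-- `μ` is a `κ`-measure on the unit sphere: `μ(S ∩ B(θ, ρ)) ≤ c ρ^κ` for all `θ ∈ S`, `ρ > 0`.
Balls of the subtype are exactly the sets `S ∩ B(θ, ρ)`, with the Euclidean distance. -/
def IsSphereKappaMeasure {d : ℕ}
    (μ : Measure (Metric.sphere (0 : EuclideanSpace ℝ (Fin d)) 1)) (κ : ℝ) : Prop :=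
  ∃ c : ℝ, ∀ (θ : Metric.sphere (0 : EuclideanSpace ℝ (Fin d)) 1) (ρ : ℝ), 0 < ρ →
    μ (Metric.ball θ ρ) ≤ ENNReal.ofReal (c * ρ ^ κ)

/-- The Lévy measure `ν(A) = ∫₀^∞ ∫_S 1_A(sθ) s^(-1-α) μ(dθ) ds`: the image under
`(s, θ) ↦ sθ` of the product of `s^(-1-α) ds` on `(0, ∞)` and `μ`. -/
def stableLevyMeasure {d : ℕ} (α : ℝ)
    (μ : Measure (Metric.sphere (0 : EuclideanSpace ℝ (Fin d)) 1)) :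
    Measure (EuclideanSpace ℝ (Fin d)) :=
  ((((volume : Measure ℝ).restrict (Set.Ioi 0)).withDensity
      (fun s => ENNReal.ofReal (s ^ (-1 - α)))).prod μ).map
    (fun z => z.1 • (z.2 : EuclideanSpace ℝ (Fin d)))

/-- The drift vector `b` of the `α`-stable semigroup. -/
def stableDrift {d : ℕ} (α : ℝ)
    (μ : Measure (Metric.sphere (0 : EuclideanSpace ℝ (Fin d)) 1)) :
    EuclideanSpace ℝ (Fin d) :=
  if α < 1 then ∫ y in {y | ‖y‖ < 1}, y ∂(stableLevyMeasure α μ)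
  else if α = 1 then 0
  else -∫ y in {y | 1 < ‖y‖}, y ∂(stableLevyMeasure α μ)

/-- The characteristic exponent
`Φ(ξ) = - ∫ (e^{i⟨ξ,y⟩} - 1 - i⟨ξ,y⟩ 1_{B(0,1)}(y)) ν(dy) - i⟨ξ,b⟩`
of a Lévy measure `ν` and a drift vector `b`. -/
def levyExponent {d : ℕ} (ν : Measure (EuclideanSpace ℝ (Fin d)))
    (b ξ : EuclideanSpace ℝ (Fin d)) : ℂ :=
  -(∫ y, (Complex.exp (Complex.I * (inner ℝ ξ y : ℝ)) - 1
        - (Metric.ball (0 : EuclideanSpace ℝ (Fin d)) 1).indicator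
            (fun y => Complex.I * ((inner ℝ ξ y : ℝ) : ℂ)) y) ∂ν)
    - Complex.I * (inner ℝ ξ b : ℝ)

/-- `P` is the convolution semigroup of probability measures whose Fourier transforms are
`∫ e^{i⟨ξ,y⟩} P_t(dy) = exp(-t Φ(ξ))`. -/
structure IsSemigroupWithExponent {d : ℕ} (P : ℝ≥0 → Measure (EuclideanSpace ℝ (Fin d)))
    (Φ : EuclideanSpace ℝ (Fin d) → ℂ) : Prop where
  isProbabilityMeasure : ∀ t, IsProbabilityMeasure (P t)
  conv_eq : ∀ s t, (P s).conv (P t) = P (s + t)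
  charFun_eq : ∀ t ξ, charFun (P t) ξ = Complex.exp (-((t : ℝ) : ℂ) * Φ ξ)

/-- `P` is the `α`-stable semigroup with spectral measure `μ`. -/
def IsStableSemigroup {d : ℕ} (α : ℝ)
    (μ : Measure (Metric.sphere (0 : EuclideanSpace ℝ (Fin d)) 1))
    (P : ℝ≥0 → Measure (EuclideanSpace ℝ (Fin d))) : Prop :=
  IsSemigroupWithExponent P (levyExponent (stableLevyMeasure α μ) (stableDrift α μ))

end

/-!
# Density estimates for anisotropic stable semigroups

Small jumps contribute a smooth density decaying faster than any fixed power, obtained by Fourier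
inversion; the large jumps are added through the exponential series of a finite measure, and the
homogeneity of the characteristic exponent reduces all times to time one.
-/

/-! Write `ν` for the Lévy measure and `m` for its restriction to `|y| ≥ 1`, a finite measure. In
the variable `ξ = -2πv` the transform at time one factors as `exp(-Φ) = e^{-m(V)} · e^h · e^{m̂}`,
where `h` collects the compensated jumps in the unit ball and the drift.

Near the origin `ν` has finite moments of all orders at least 2, so `h` is smooth with derivatives
of at most linear growth. Nondegeneracy gives `Re h ≤ c - c|v|^α`. Hence `e^h` has integrable
derivatives of every order, and its inverse transform `q` decays faster than any power
(`exists_norm_fourierInv_cexp_le`).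

Expanding `e^{m̂}` expresses the density at time one as `e^{-m(V)} Σ q * m^{*n} / n!`. The
`(γ-1)`-condition yields `ν(B(w,r) ∩ {|y| ≥ R}) ≤ C r^γ R^{-γ-α}`
(`exists_stableLevyMeasure_ball_inter_le`), hence `∫_{|y| ≥ R} |q(z-y)| ν(dy) ≤ D R^{-γ-α}`
uniformly in `z`. By induction each term satisfies `|q * m^{*n}(x)| ≤ D |x|^{-γ-α} K^n`, where `K`
depends only on `γ + α` and `m(V)` (`enorm_fourierInv_mul_charFun_pow_le`), and the factorials make
the series converge.

The drift is the one for which `Φ(rξ) = r^α Φ(ξ)` (`levyExponent_smul`), so `p_t(x) = t^{-d/α}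
p_1(t^{-1/α} x)`, and the estimate at time one gives all times. The bound without `x` is the
integral of `|e^{-Φ}|`. -/

open scoped FourierTransform ContDiff ENNReal

/-! ### Fourier inversion for finite measures -/

section Inversion
variable {V : Type*} [NormedAddCommGroup V] [InnerProductSpace ℝ V] [MeasurableSpace V]

theorem charFun_neg_two_pi_smul (P : Measure V) (v : V) :
    charFun P (-(2 * Real.pi) • v) =
      VectorFourier.fourierIntegral Real.fourierChar P (innerₗ V) 1 v := by
  rw [charFun_eq_fourierIntegral', smul_smul]
  have : -(2 * Real.pi)⁻¹ * -(2 * Real.pi) = 1 := by field_simp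
  rw [this, one_smul]

variable [FiniteDimensional ℝ V] [BorelSpace V]

theorem continuous_fourierInv {f : V → ℂ} (hf : Integrable f) : Continuous (𝓕⁻ f) := by
  refine VectorFourier.fourierIntegral_continuous (L := -innerₗ V) Real.continuous_fourierChar ?_ hf
  simp only [LinearMap.neg_apply, innerₗ_apply_apply]
  fun_prop

theorem norm_fourierInv_le (f : V → ℂ) (x : V) : ‖𝓕⁻ f x‖ ≤ ∫ v, ‖f v‖ :=
  VectorFourier.norm_fourierIntegral_le_integral_norm _ _ _ _ _

/-- Self-adjointness of the Fourier integral, used twice with `h = 𝓕⁻ G`: both sides equal `∫ h ·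
P̂`, on the left because `G = 𝓕 h` is paired with the constant 1 under `P`, on the right by moving
`𝓕⁻` from `P̂` to `G`. -/
theorem integral_schwartz_eq_integral_mul_fourierInv (P : Measure V) [IsFiniteMeasure P]
    (hF : Integrable (fun v : V => charFun P (-(2 * Real.pi) • v))) (G : SchwartzMap V ℂ) :
    ∫ x, G x ∂P = ∫ x, G x * 𝓕⁻ (fun v : V => charFun P (-(2 * Real.pi) • v)) x := by
  have hL : Continuous fun p : V × V => (innerₗ V) p.1 p.2 := by
    simp only [innerₗ_apply_apply]; fun_prop
  have hL' : Continuous fun p : V × V => (-innerₗ V) p.1 p.2 := by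
    simp only [LinearMap.neg_apply, innerₗ_apply_apply]; fun_prop
  set h : SchwartzMap V ℂ := 𝓕⁻ G with hh
  have hG : 𝓕 (h : V → ℂ) = G := by
    rw [← SchwartzMap.fourier_coe, hh, FourierTransform.fourier_fourierInv_eq]
  have h1 := VectorFourier.integral_fourierIntegral_smul_eq_flip (e := Real.fourierChar)
    (μ := (volume : Measure V)) (ν := P) (L := innerₗ V) (f := (h : V → ℂ)) (g := (1 : V → ℂ))
    Real.continuous_fourierChar hL h.integrable (integrable_const 1)
  have h2 := VectorFourier.integral_fourierIntegral_smul_eq_flip (e := Real.fourierChar)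
    (μ := (volume : Measure V)) (ν := (volume : Measure V)) (L := -innerₗ V) (f := (G : V → ℂ))
    (g := fun v : V => charFun P (-(2 * Real.pi) • v))
    Real.continuous_fourierChar hL' G.integrable hF
  have e1 : VectorFourier.fourierIntegral Real.fourierChar volume (innerₗ V) (h : V → ℂ) = G := hG
  have e2 : VectorFourier.fourierIntegral Real.fourierChar volume (-innerₗ V) (G : V → ℂ) = h := by
    rw [hh, SchwartzMap.fourierInv_coe]; rfl
  have e3 : (-innerₗ V).flip = -innerₗ V := by
    ext x y; simp [real_inner_comm]
  have e4 : (innerₗ V).flip = innerₗ V := by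
    ext x y; simp
  rw [e1, e4] at h1
  rw [e2, e3] at h2
  simp only [smul_eq_mul, Pi.one_apply, mul_one] at h1 h2
  rw [h1]
  simp_rw [← charFun_neg_two_pi_smul]
  rw [h2]
  rfl

theorem eq_withDensity_fourierInv_charFun (P : Measure V) [IsFiniteMeasure P]
    (hF : Integrable (fun v : V => charFun P (-(2 * Real.pi) • v))) :
    (∀ x, 0 ≤ (𝓕⁻ (fun v : V => charFun P (-(2 * Real.pi) • v)) x).re) ∧
    P = (volume : Measure V).withDensity (fun x => ENNReal.ofReal
      (𝓕⁻ (fun v : V => charFun P (-(2 * Real.pi) • v)) x).re) := by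
  set p : V → ℝ := fun x => (𝓕⁻ (fun v : V => charFun P (-(2 * Real.pi) • v)) x).re with hp
  have hpc : Continuous p := Complex.continuous_re.comp (continuous_fourierInv hF)
  have key : ∀ g : V → ℝ, ContDiff ℝ ∞ g → HasCompactSupport g →
      ∫ x, g x ∂P = ∫ x, g x * p x := by
    intro g hg hgc
    have hgc' : HasCompactSupport (fun x => (g x : ℂ)) := hgc.comp_left (g := fun r : ℝ => (r : ℂ)) (by simp)
    have hg' : ContDiff ℝ ∞ (fun x => (g x : ℂ)) := Complex.ofRealCLM.contDiff.comp hg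
    have := integral_schwartz_eq_integral_mul_fourierInv P hF (hgc'.toSchwartzMap hg')
    have h3 := congrArg Complex.re this
    simp only [HasCompactSupport.toSchwartzMap_toFun] at h3
    rw [integral_complex_ofReal, Complex.ofReal_re] at h3
    rw [h3]
    have hint : Integrable (fun x => (g x : ℂ) *
        𝓕⁻ (fun v : V => charFun P (-(2 * Real.pi) • v)) x) := by
      refine Continuous.integrable_of_hasCompactSupport ?_ hgc'.mul_right
      exact hg'.continuous.mul (continuous_fourierInv hF)
    have := integral_re hint
    simp only [RCLike.re_eq_complex_re, Complex.re_ofReal_mul] at this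
    rw [hp, ← this]
  -- The sign of `p` is not yet known, so `p · volume` is not available as a positive measure. Both
  -- `P` and `volume` are instead compared through their densities with respect to the common
  -- dominating measure `Λ`. The resulting identity also forces `p ≥ 0` almost everywhere, hence
  -- everywhere by continuity.
  set Λ : Measure V := P + volume with hΛ
  have hfin : IsFiniteMeasureOnCompacts Λ :=
    ⟨fun K hK => by simp [hΛ, hK.measure_lt_top]⟩
  have hPΛ : P ≤ Λ := Measure.le_add_right le_rfl
  have hvΛ : volume ≤ Λ := Measure.le_add_left le_rfl
  have hae : ∀ᵐ x ∂Λ, (P.rnDeriv Λ x).toReal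
      = ((volume : Measure V).rnDeriv Λ x).toReal * p x := by
    refine ae_eq_of_integral_contDiff_smul_eq ?_ ?_ ?_
    · exact Measure.integrable_toReal_rnDeriv.locallyIntegrable
    · refine (hpc.locallyIntegrable (μ := Λ)).mono ?_ ?_
      · exact ((Measure.measurable_rnDeriv _ _).ennreal_toReal.mul
          hpc.measurable).aestronglyMeasurable
      · filter_upwards [Measure.rnDeriv_le_one_of_le hvΛ] with x hx
        rw [norm_mul]
        refine mul_le_of_le_one_left (norm_nonneg _) ?_
        rw [Real.norm_of_nonneg ENNReal.toReal_nonneg]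
        exact ENNReal.toReal_le_of_le_ofReal zero_le_one (by simpa using hx)
    · intro g hg hgc
      have h1 := integral_rnDeriv_smul (f := g) (Measure.absolutelyContinuous_of_le hPΛ)
      have h2 := integral_rnDeriv_smul (f := fun x => g x * p x)
        (Measure.absolutelyContinuous_of_le hvΛ)
      simp only [smul_eq_mul] at h1 h2 ⊢
      rw [← key g hg hgc] at h2
      calc _ = ∫ x, g x ∂P := by rw [← h1]; exact integral_congr_ae (.of_forall fun x => mul_comm _ _)
        _ = _ := by
          rw [← h2]; exact integral_congr_ae (.of_forall fun x => by ring)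
  have hvac : (volume : Measure V) ≪ Λ := Measure.absolutelyContinuous_of_le hvΛ
  have hpos : ∀ᵐ x, 0 ≤ p x := by
    filter_upwards [hvac.ae_le hae, Measure.rnDeriv_pos hvac,
      hvac.ae_le (Measure.rnDeriv_ne_top (volume : Measure V) Λ)] with x h1 h2 h3
    have h4 : 0 < ((volume : Measure V).rnDeriv Λ x).toReal := ENNReal.toReal_pos h2.ne' h3
    have h5 : 0 ≤ ((volume : Measure V).rnDeriv Λ x).toReal * p x := by
      rw [← h1]; exact ENNReal.toReal_nonneg
    exact nonneg_of_mul_nonneg_right h5 h4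
  refine ⟨fun x => ?_, ?_⟩
  · by_contra hx
    have hopen : IsOpen {y | p y < 0} := isOpen_lt hpc continuous_const
    have h0 : volume {y | p y < 0} = 0 := by simpa [ae_iff] using hpos
    have := (hopen.measure_eq_zero_iff volume).1 h0
    exact (Set.eq_empty_iff_forall_notMem.1 this x) (not_le.1 hx)
  · change P = volume.withDensity (fun x => ENNReal.ofReal (p x))
    refine (Measure.withDensity_rnDeriv_eq P Λ (Measure.absolutelyContinuous_of_le hPΛ)).symm.trans ?_
    conv_rhs => rw [← Measure.withDensity_rnDeriv_eq (volume : Measure V) Λ hvac]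
    rw [← withDensity_mul _ (Measure.measurable_rnDeriv _ _) (g := fun x => ENNReal.ofReal (p x))
      (ENNReal.measurable_ofReal.comp hpc.measurable)]
    refine withDensity_congr_ae ?_
    filter_upwards [hae, Measure.rnDeriv_ne_top P Λ,
      Measure.rnDeriv_ne_top (volume : Measure V) Λ] with x h1 h2 h3
    rw [Pi.mul_apply, ← ENNReal.ofReal_toReal h2, h1, ENNReal.ofReal_mul ENNReal.toReal_nonneg,
      ENNReal.ofReal_toReal h3]

end Inversion

/-! ### Adding the large jumps: the exponential series of a finite measure -/

section CompoundPoisson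
variable {V : Type*} [NormedAddCommGroup V] [InnerProductSpace ℝ V] [FiniteDimensional ℝ V]
  [MeasurableSpace V] [BorelSpace V]

theorem integrable_mul_charFun {f : V → ℂ} (hf : Integrable f) (m : Measure V)
    [IsFiniteMeasure m] : Integrable (fun v => f v * charFun m (-(2 * Real.pi) • v)) := by
  refine hf.mul_bdd (c := m.real Set.univ) ?_ (.of_forall fun v => norm_charFun_le _)
  exact (measurable_charFun.comp (measurable_const_smul (-(2 * Real.pi)))).aestronglyMeasurable

/-- Fubini. Each further factor `m̂` thus costs one convolution with `m`, which lets bounds be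
iterated in the power `n`. -/
theorem fourierInv_mul_charFun {f : V → ℂ} (hf : Integrable f) (m : Measure V)
    [IsFiniteMeasure m] (x : V) :
    𝓕⁻ (fun v => f v * charFun m (-(2 * Real.pi) • v)) x = ∫ y, 𝓕⁻ f (x - y) ∂m := by
  simp_rw [Real.fourierInv_eq, charFun_neg_two_pi_smul, VectorFourier.fourierIntegral,
    Circle.smul_def, smul_eq_mul, innerₗ_apply_apply, Pi.one_apply, mul_one]
  have h1 : ∀ v y : V, (Real.fourierChar (inner ℝ v (x - y)) : ℂ) * f v
      = (Real.fourierChar (inner ℝ v x) : ℂ) * (f v * (Real.fourierChar (-inner ℝ y v) : ℂ)) := by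
    intro v y
    rw [inner_sub_right, sub_eq_add_neg, AddChar.map_add_eq_mul, real_inner_comm v y]
    push_cast
    ring
  simp_rw [h1]
  rw [integral_integral_swap]
  · congr 1 with v
    rw [← integral_const_mul, ← integral_const_mul]
  · have hb : Integrable (fun z : V × V => f z.2) (m.prod volume) := hf.comp_snd m
    have : Integrable (fun z : V × V => ((Real.fourierChar (inner ℝ z.2 x) : ℂ) *
        (Real.fourierChar (-inner ℝ z.1 z.2) : ℂ)) * f z.2) (m.prod volume) := by
      refine hb.bdd_mul (c := 1) ?_ (.of_forall fun z => by
        rw [norm_mul, Circle.norm_coe, Circle.norm_coe, one_mul])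
      refine Continuous.aestronglyMeasurable ?_
      fun_prop
    refine this.congr (.of_forall fun z => ?_)
    simp only [Function.uncurry]
    ring

variable (f : V → ℂ) (m : Measure V) [IsFiniteMeasure m]

theorem integrable_mul_charFun_pow (hf : Integrable f) (n : ℕ) :
    Integrable (fun v => f v * charFun m (-(2 * Real.pi) • v) ^ n) := by
  induction n with
  | zero => simpa using hf
  | succ n ih =>
    refine (integrable_mul_charFun ih m).congr (.of_forall fun v => ?_)
    simp only [pow_succ, mul_assoc]

theorem enorm_fourierInv_mul_charFun_pow_succ_le (hf : Integrable f) (n : ℕ) (x : V) :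
    ‖𝓕⁻ (fun v => f v * charFun m (-(2 * Real.pi) • v) ^ (n + 1)) x‖ₑ ≤
      ∫⁻ y, ‖𝓕⁻ (fun v => f v * charFun m (-(2 * Real.pi) • v) ^ n) (x - y)‖ₑ ∂m := by
  have := fourierInv_mul_charFun (integrable_mul_charFun_pow f m hf n) m x
  simp_rw [mul_assoc, ← pow_succ] at this
  rw [this]
  exact enorm_integral_le_lintegral_enorm _

/-- Tonelli moves the new convolution variable `u` outside, where it only translates `z`. Uniformity
of the hypothesis in `z` is what makes the induction close, each step costing the total mass. -/
theorem setLIntegral_fourierInv_mul_charFun_pow_le (hf : Integrable f) (T : Set V)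
    (b : ℝ≥0∞)
    (h : ∀ z, ∫⁻ y in T, ‖𝓕⁻ f (z - y)‖ₑ ∂m ≤ b) (n : ℕ) (z : V) :
    ∫⁻ y in T, ‖𝓕⁻ (fun v => f v * charFun m (-(2 * Real.pi) • v) ^ n) (z - y)‖ₑ ∂m
      ≤ b * m Set.univ ^ n := by
  induction n generalizing z with
  | zero => simpa using h z
  | succ n ih =>
    have hc := continuous_fourierInv (integrable_mul_charFun_pow f m hf n)
    calc _ ≤ ∫⁻ y in T, ∫⁻ u, ‖𝓕⁻ (fun v => f v * charFun m (-(2 * Real.pi) • v) ^ n)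
            (z - y - u)‖ₑ ∂m ∂m :=
          lintegral_mono fun y => enorm_fourierInv_mul_charFun_pow_succ_le f m hf n _
      _ = ∫⁻ u, ∫⁻ y in T, ‖𝓕⁻ (fun v => f v * charFun m (-(2 * Real.pi) • v) ^ n)
            (z - u - y)‖ₑ ∂m ∂m := by
          rw [lintegral_lintegral_swap]
          · exact lintegral_congr fun u => lintegral_congr fun y => by rw [sub_right_comm]
          · exact (hc.comp (by fun_prop : Continuous fun p : V × V =>
              z - p.1 - p.2)).enorm.aemeasurable
      _ ≤ ∫⁻ u, b * m Set.univ ^ n ∂m := lintegral_mono fun u => ih _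
      _ = _ := by rw [lintegral_const, pow_succ, mul_assoc]

/-- The convolution defining step `n + 1` is split at `|y| = |x|/2`. For large `y` the uniform tail
bound applies with `R = |x|/2`; for small `y` one has `|x - y| ≥ |x|/2` and the induction hypothesis
applies. Halving `|x|` costs `2^s` in both cases, so the growth factor is `2^s (1 + m(V))`. -/
theorem enorm_fourierInv_mul_charFun_pow_le (hf : Integrable f) {s D : ℝ} (hs : 0 ≤ s)
    (h0 : ∀ x, x ≠ 0 → ‖𝓕⁻ f x‖ ≤ D * ‖x‖ ^ (-s))
    (h1 : ∀ z R, 0 < R → ∫⁻ y in {y | R ≤ ‖y‖}, ‖𝓕⁻ f (z - y)‖ₑ ∂m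
      ≤ ENNReal.ofReal (D * R ^ (-s))) (n : ℕ) (x : V) (hx : x ≠ 0) :
    ‖𝓕⁻ (fun v => f v * charFun m (-(2 * Real.pi) • v) ^ n) x‖ₑ
      ≤ ENNReal.ofReal (D * ‖x‖ ^ (-s)) * (ENNReal.ofReal (2 ^ s) * (1 + m Set.univ)) ^ n := by
  have h2s : (1 : ℝ≥0∞) ≤ ENNReal.ofReal (2 ^ s) := by
    rw [← ENNReal.ofReal_one]
    exact ENNReal.ofReal_le_ofReal (Real.one_le_rpow one_le_two hs)
  have hhalf : ∀ x : V, ENNReal.ofReal (D * (‖x‖ / 2) ^ (-s))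
      = ENNReal.ofReal (2 ^ s) * ENNReal.ofReal (D * ‖x‖ ^ (-s)) := by
    intro x
    rw [← ENNReal.ofReal_mul (by positivity), Real.div_rpow (norm_nonneg _) zero_le_two,
      Real.rpow_neg zero_le_two, div_inv_eq_mul]
    congr 1
    ring
  have hD : 0 ≤ D := by
    have h := (norm_nonneg _).trans (h0 x hx)
    exact nonneg_of_mul_nonneg_left h (Real.rpow_pos_of_pos (norm_pos_iff.2 hx) _)
  induction n generalizing x with
  | zero =>
    simp only [pow_zero, mul_one]
    rw [← ofReal_norm]
    exact ENNReal.ofReal_le_ofReal (h0 x hx)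
  | succ n ih =>
    set K := ENNReal.ofReal (2 ^ s) * (1 + m Set.univ) with hK
    set W := ENNReal.ofReal (D * ‖x‖ ^ (-s)) with hW
    set M := m Set.univ with hM
    have hMK : M ≤ K := calc
      M ≤ 1 * (1 + M) := by rw [one_mul]; exact le_add_self
      _ ≤ K := by rw [hK]; gcongr
    set q := 𝓕⁻ (fun v => f v * charFun m (-(2 * Real.pi) • v) ^ n) with hq
    have hxn : 0 < ‖x‖ / 2 := by have := norm_pos_iff.2 hx; positivity
    set T : Set V := {y | ‖x‖ / 2 ≤ ‖y‖} with hT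
    have hTm : MeasurableSet T := measurableSet_le measurable_const measurable_norm
    refine (enorm_fourierInv_mul_charFun_pow_succ_le f m hf n x).trans ?_
    rw [← lintegral_add_compl _ hTm]
    have e1 : ∫⁻ y in T, ‖q (x - y)‖ₑ ∂m ≤ (ENNReal.ofReal (2 ^ s) * W) * K ^ n := by
      refine (setLIntegral_fourierInv_mul_charFun_pow_le f m hf T _
        (fun z => h1 z _ hxn) n x).trans ?_
      rw [hhalf x]
      gcongr
    have e2 : ∫⁻ y in Tᶜ, ‖q (x - y)‖ₑ ∂m ≤ (ENNReal.ofReal (2 ^ s) * W) * K ^ n * M := by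
      calc _ ≤ ∫⁻ y in Tᶜ, (ENNReal.ofReal (2 ^ s) * W) * K ^ n ∂m := by
            refine setLIntegral_mono measurable_const fun y hy => ?_
            have hy' : ‖y‖ < ‖x‖ / 2 := by simpa [hT] using hy
            have hxy : ‖x‖ / 2 ≤ ‖x - y‖ := by
              have := norm_sub_norm_le x y
              linarith
            refine (ih (x - y) (norm_pos_iff.1 (hxn.trans_le hxy))).trans ?_
            rw [hW, ← hhalf x]
            gcongr ENNReal.ofReal (D * ?_) * _
            exact Real.rpow_le_rpow_of_nonpos hxn hxy (by linarith)
        _ ≤ _ := by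
          rw [setLIntegral_const]
          gcongr
          exact measure_mono (Set.subset_univ _)
    calc _ ≤ (ENNReal.ofReal (2 ^ s) * W) * K ^ n + (ENNReal.ofReal (2 ^ s) * W) * K ^ n * M :=
          add_le_add e1 e2
      _ = W * K ^ (n + 1) := by
        rw [pow_succ, hK]; ring

/-- The `n`-th term is dominated by `|f| m(V)^n / n!`, which allows exchanging sum and integral. -/
theorem hasSum_fourierInv_mul_charFun_pow (hf : Integrable f) (x : V) :
    HasSum (fun n : ℕ => ((n.factorial : ℝ)⁻¹ : ℂ) *
      𝓕⁻ (fun v => f v * charFun m (-(2 * Real.pi) • v) ^ n) x)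
      (𝓕⁻ (fun v => f v * Complex.exp (charFun m (-(2 * Real.pi) • v))) x) := by
  set M := m.real Set.univ with hM
  set φ : V → ℂ := fun v => charFun m (-(2 * Real.pi) • v) with hφ
  simp_rw [Real.fourierInv_eq, Circle.smul_def, smul_eq_mul]
  have hn : ∀ v, ‖φ v‖ ≤ M := fun v => norm_charFun_le _
  have hi : ∀ n : ℕ, Integrable (fun v => f v * φ v ^ n) := integrable_mul_charFun_pow f m hf
  have hi' : ∀ n : ℕ, Integrable (fun v : V => ((n.factorial : ℝ)⁻¹ : ℂ) *
      ((Real.fourierChar (inner ℝ v x) : ℂ) * (f v * φ v ^ n))) := by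
    intro n
    refine Integrable.const_mul ?_ _
    exact (hi n).bdd_mul (c := 1) (Continuous.aestronglyMeasurable (by fun_prop))
      (.of_forall fun v => (Circle.norm_coe _).le)
  have hs : Summable fun n : ℕ => ∫ v, ‖((n.factorial : ℝ)⁻¹ : ℂ) *
      ((Real.fourierChar (inner ℝ v x) : ℂ) * (f v * φ v ^ n))‖ := by
    have hs0 : Summable fun n : ℕ => (M ^ n / n.factorial) * ∫ v, ‖f v‖ :=
      (Real.summable_pow_div_factorial M).mul_right (∫ v, ‖f v‖)
    refine Summable.of_nonneg_of_le (fun n => integral_nonneg fun v => norm_nonneg _)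
      (fun n => ?_) hs0
    rw [← integral_const_mul]
    refine integral_mono (hi' n).norm (hf.norm.const_mul _) fun v => ?_
    simp only [norm_mul, norm_pow, norm_inv, Complex.norm_real, Circle.norm_coe, one_mul]
    rw [Real.norm_of_nonneg (by positivity), div_eq_inv_mul, mul_assoc, mul_comm (M ^ n)]
    gcongr
    exact hn v
  have hts : ∀ v, ∑' n : ℕ, ((n.factorial : ℝ)⁻¹ : ℂ) *
      ((Real.fourierChar (inner ℝ v x) : ℂ) * (f v * φ v ^ n)) =
      (Real.fourierChar (inner ℝ v x) : ℂ) * (f v * Complex.exp (φ v)) := fun v => ?_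
  · have := hasSum_integral_of_summable_integral_norm hi' hs
    simp_rw [integral_const_mul, hts] at this
    exact this
  have h3 := NormedSpace.exp_series_hasSum_exp' (𝕂 := ℂ) (φ v)
  rw [← Complex.exp_eq_exp_ℂ] at h3
  have h4 := (h3.mul_left (f v)).mul_left (Real.fourierChar (inner ℝ v x) : ℂ)
  refine (tsum_congr fun n => ?_).trans h4.tsum_eq
  simp only [smul_eq_mul, Complex.ofReal_natCast]
  ring

theorem norm_fourierInv_mul_exp_charFun_le (hf : Integrable f) {s D : ℝ} (hs : 0 ≤ s)
    (h0 : ∀ x, x ≠ 0 → ‖𝓕⁻ f x‖ ≤ D * ‖x‖ ^ (-s))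
    (h1 : ∀ z R, 0 < R → ∫⁻ y in {y | R ≤ ‖y‖}, ‖𝓕⁻ f (z - y)‖ₑ ∂m
      ≤ ENNReal.ofReal (D * R ^ (-s))) (x : V) (hx : x ≠ 0) :
    ‖𝓕⁻ (fun v => f v * Complex.exp (charFun m (-(2 * Real.pi) • v))) x‖
      ≤ D * Real.exp (2 ^ s * (1 + m.real Set.univ)) * ‖x‖ ^ (-s) := by
  have h2 : ∀ n : ℕ, ‖𝓕⁻ (fun v => f v * charFun m (-(2 * Real.pi) • v) ^ n) x‖
      ≤ D * ‖x‖ ^ (-s) * (2 ^ s * (1 + m.real Set.univ)) ^ n := by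
    intro n
    have h3 := enorm_fourierInv_mul_charFun_pow_le f m hf hs h0 h1 n x hx
    have hD : 0 ≤ D * ‖x‖ ^ (-s) := (norm_nonneg _).trans (h0 x hx)
    rw [← ofReal_measureReal, ← ENNReal.ofReal_one, ← ENNReal.ofReal_add zero_le_one
      measureReal_nonneg, ← ENNReal.ofReal_mul (by positivity), ← ENNReal.ofReal_pow
      (by positivity), ← ENNReal.ofReal_mul hD, ← ofReal_norm,
      ENNReal.ofReal_le_ofReal_iff (by positivity)] at h3
    exact h3
  have h4 := hasSum_fourierInv_mul_charFun_pow f m hf x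
  rw [← h4.tsum_eq]
  have h5 := (NormedSpace.exp_series_hasSum_exp' (𝕂 := ℝ)
    (2 ^ s * (1 + m.real Set.univ) : ℝ)).mul_left (D * ‖x‖ ^ (-s))
  rw [← Real.exp_eq_exp_ℝ] at h5
  refine (tsum_of_norm_bounded h5 fun n => ?_).trans (le_of_eq (by ring))
  rw [norm_mul, norm_inv, Complex.norm_real, Real.norm_of_nonneg (by positivity), smul_eq_mul,
    mul_left_comm]
  gcongr
  exact h2 n

end CompoundPoisson

/-! ### Decay of the inverse transform of `e^h` -/

theorem norm_iteratedFDeriv_cexp_le (n : ℕ) (z : ℂ) :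
    ‖iteratedFDeriv ℝ n Complex.exp z‖ ≤ ‖Complex.exp z‖ := by
  induction n generalizing z with
  | zero => simp
  | succ n ih =>
    -- The real derivative of `exp` is `exp` followed by a linear map of norm at most one, so the
    -- induction loses no constant.
    have h1 : fderiv ℝ Complex.exp = (ContinuousLinearMap.mul ℝ ℂ) ∘ Complex.exp := by
      ext1 z
      have h2 := ((Complex.hasDerivAt_exp z).hasFDerivAt.restrictScalars ℝ).fderiv
      rw [h2]
      ext; simp [mul_comm]
    rw [← norm_iteratedFDeriv_fderiv, h1]
    refine (ContinuousLinearMap.norm_iteratedFDeriv_comp_left (N := ∞) _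
      (Complex.contDiff_exp (𝕜 := ℝ)).contDiffAt (by exact_mod_cast le_top)).trans ?_
    calc _ ≤ 1 * ‖Complex.exp z‖ := by
          gcongr
          · exact ContinuousLinearMap.opNorm_mul_le ℝ ℂ
          · exact ih z
      _ = _ := one_mul _

theorem exists_one_add_pow_mul_exp_neg_rpow_le (K : ℕ) {c a : ℝ} (hc : 0 < c) (ha : 0 < a) :
    ∃ C, 0 < C ∧ ∀ r : ℝ, 0 ≤ r → (1 + r) ^ K * Real.exp (-c * r ^ a) ≤ C := by
  have h1 := (tendsto_rpow_mul_exp_neg_mul_atTop_nhds_zero (K / a) c hc).comp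
    (tendsto_rpow_atTop ha)
  have h2 := (h1.eventually (gt_mem_nhds zero_lt_one)).and (Filter.eventually_ge_atTop 1)
  obtain ⟨R, hR⟩ := Filter.eventually_atTop.1 h2
  have hR1 : 1 ≤ R := (hR R le_rfl).2
  refine ⟨(1 + R) ^ K + 2 ^ K, by positivity, fun r hr => ?_⟩
  rcases le_total r R with h | h
  · calc _ ≤ (1 + R) ^ K * 1 := by
          gcongr
          rw [Real.exp_le_one_iff]
          have := Real.rpow_nonneg hr a
          nlinarith
      _ ≤ _ := by rw [mul_one]; linarith [pow_pos (zero_lt_two' ℝ) K]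
  · obtain ⟨h3, h4⟩ := hR r h
    simp only [Function.comp] at h3
    rw [← Real.rpow_mul hr, mul_div_cancel₀ _ ha.ne', Real.rpow_natCast] at h3
    calc (1 + r) ^ K * Real.exp (-c * r ^ a) ≤ (2 * r) ^ K * Real.exp (-c * r ^ a) := by
          gcongr; linarith
      _ = 2 ^ K * (r ^ K * Real.exp (-c * r ^ a)) := by ring
      _ ≤ 2 ^ K * 1 := by gcongr
      _ ≤ _ := by rw [mul_one]; linarith [show 0 ≤ (1 + R) ^ K by positivity]

section Decay
variable {V : Type*} [NormedAddCommGroup V] [InnerProductSpace ℝ V] [FiniteDimensional ℝ V]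
  [MeasurableSpace V] [BorelSpace V]

theorem norm_cexp_le_of_re_le {V : Type*} [NormedAddCommGroup V] {h : V → ℂ} {c a C' : ℝ}
    (hre : ∀ v, (h v).re ≤ C' - c * ‖v‖ ^ a) (v : V) :
    ‖Complex.exp (h v)‖ ≤ Real.exp C' * Real.exp (-c * ‖v‖ ^ a) := by
  rw [Complex.norm_exp, ← Real.exp_add, Real.exp_le_exp]
  linarith [hre v]

/-- By the Faà di Bruno bound the `n`-th derivative is at most `n! |e^h|` times a polynomial of
degree `n` in `1 + |v|`, and `exp(-c|v|^a)` absorbs any polynomial together with the integrable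
weight of exponent `d + 1`. -/
theorem integrable_iteratedFDeriv_cexp {h : V → ℂ} (hh : ContDiff ℝ ∞ h) {c a C C' : ℝ} {N : ℕ}
    (hc : 0 < c) (ha : 0 < a)
    (hd : ∀ n, 1 ≤ n → n ≤ N → ∀ v, ‖iteratedFDeriv ℝ n h v‖ ≤ C * (1 + ‖v‖))
    (hre : ∀ v, (h v).re ≤ C' - c * ‖v‖ ^ a) {n : ℕ} (hn : n ≤ N) :
    Integrable (iteratedFDeriv ℝ n (fun v => Complex.exp (h v))) := by
  have hsm : ContDiff ℝ ∞ (fun v => Complex.exp (h v)) := hh.cexp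
  set d := Module.finrank ℝ V
  obtain ⟨C2, hC2, hC2'⟩ := exists_one_add_pow_mul_exp_neg_rpow_le (n + (d + 1)) hc ha
  have hi : Integrable (fun v : V => (1 + ‖v‖) ^ (-((d + 1 : ℕ) : ℝ))) :=
    integrable_one_add_norm (by push_cast; simp [d])
  -- The composition bound wants the `i`-th derivative of `h` below `D^i`. With `D = C3 (1 + |v|) ≥
  -- 1`, a bound by `D` itself suffices.
  set C3 := max C 1 with hC3
  have hC31 : 1 ≤ C3 := le_max_right _ _
  refine (hi.const_mul (n.factorial * Real.exp C' * C3 ^ n * C2)).mono' ?_ (.of_forall fun v => ?_)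
  · exact (hsm.continuous_iteratedFDeriv (by exact_mod_cast le_top)).aestronglyMeasurable
  · have h1v : 1 ≤ 1 + ‖v‖ := by linarith [norm_nonneg v]
    have hD : 1 ≤ C3 * (1 + ‖v‖) := one_le_mul_of_one_le_of_one_le hC31 h1v
    have h1 := norm_iteratedFDeriv_comp_le (n := n) (N := ∞) (Complex.contDiff_exp (𝕜 := ℝ)) hh
      (by exact_mod_cast le_top) v (C := ‖Complex.exp (h v)‖) (D := C3 * (1 + ‖v‖))
      (fun i _ => norm_iteratedFDeriv_cexp_le i _)
      (fun i hi1 hin => by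
        refine (hd i hi1 (hin.trans hn) v).trans (le_trans ?_ (le_self_pow₀ hD (by omega)))
        gcongr
        exact le_max_left _ _)
    refine h1.trans ?_
    have h2 := hC2' ‖v‖ (norm_nonneg v)
    rw [Real.rpow_neg (by positivity), Real.rpow_natCast]
    calc _ ≤ n.factorial * (Real.exp C' * Real.exp (-c * ‖v‖ ^ a)) * (C3 * (1 + ‖v‖)) ^ n := by
          gcongr
          exact norm_cexp_le_of_re_le hre v
      _ = n.factorial * Real.exp C' * C3 ^ n * ((1 + ‖v‖) ^ (n + (d + 1)) *
            Real.exp (-c * ‖v‖ ^ a)) * ((1 + ‖v‖) ^ (d + 1))⁻¹ := by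
          rw [pow_add, mul_pow]
          field_simp
      _ ≤ _ := by gcongr

theorem integrable_cexp_of_re_le {h : V → ℂ} (hh : ContDiff ℝ ∞ h) {c a C' : ℝ}
    (hc : 0 < c) (ha : 0 < a) (hre : ∀ v, (h v).re ≤ C' - c * ‖v‖ ^ a) :
    Integrable (fun v => Complex.exp (h v)) := by
  -- For `N = 0` the hypothesis on derivatives is vacuous, so any `C` serves.
  have := integrable_iteratedFDeriv_cexp hh hc ha (C := 0) (N := 0)
    (fun n h1 h2 => by omega) hre le_rfl
  rw [← integrable_norm_iff (hh.cexp.continuous).aestronglyMeasurable]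
  simpa using this.norm

/-- Derivatives up to order `N` are integrable, so `|x|^n |𝓕⁻ e^h|` is bounded for `n = 0` and `n =
N`; these combine through `(1 + |x|)^N ≤ 2^(N-1) (1 + |x|^N)`. -/
theorem exists_norm_fourierInv_cexp_le {h : V → ℂ} (hh : ContDiff ℝ ∞ h) {c a C C' : ℝ} {N : ℕ}
    (hc : 0 < c) (ha : 0 < a)
    (hd : ∀ n, 1 ≤ n → n ≤ N → ∀ v, ‖iteratedFDeriv ℝ n h v‖ ≤ C * (1 + ‖v‖))
    (hre : ∀ v, (h v).re ≤ C' - c * ‖v‖ ^ a) :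
    ∃ A, 0 ≤ A ∧ ∀ x, ‖𝓕⁻ (fun v => Complex.exp (h v)) x‖ ≤ A * ((1 + ‖x‖) ^ N)⁻¹ := by
  have hsm : ContDiff ℝ ∞ (fun v => Complex.exp (h v)) := hh.cexp
  have h1 : ∀ n : ℕ, n ≤ N → ∃ B, ∀ w,
      ‖w‖ ^ n * ‖𝓕 (fun v => Complex.exp (h v)) w‖ ≤ B := by
    intro n hn
    have key := fun w => Real.pow_mul_norm_iteratedFDeriv_fourier_le (K := 0) (N := N) (k := 0) (n := n)
      (f := fun v => Complex.exp (h v)) (hsm.of_le (by exact_mod_cast le_top)) (fun k n hk hn => by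
        have hk0 : k = 0 := by simpa using hk
        subst hk0
        simpa using (integrable_iteratedFDeriv_cexp hh hc ha hd hre (by exact_mod_cast hn)).norm)
      le_rfl (by exact_mod_cast hn) w
    simp only [norm_iteratedFDeriv_zero] at key
    exact ⟨_, key⟩
  obtain ⟨B0, hB0⟩ := h1 0 N.zero_le
  obtain ⟨B1, hB1⟩ := h1 N le_rfl
  have hA : ∀ x, ‖𝓕⁻ (fun v => Complex.exp (h v)) x‖ ≤ (2 ^ (N - 1) * (B0 + B1)) * ((1 + ‖x‖) ^ N)⁻¹ := by
    intro x
    rw [Real.fourierInv_eq_fourier_neg, ← div_eq_mul_inv, le_div_iff₀ (by positivity)]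
    have e0 := hB0 (-x)
    have e1 := hB1 (-x)
    rw [norm_neg] at e0 e1
    have h2 := add_pow_le zero_le_one (norm_nonneg x) N
    set q := ‖𝓕 (fun v => Complex.exp (h v)) (-x)‖
    have hq : 0 ≤ q := norm_nonneg _
    calc q * (1 + ‖x‖) ^ N ≤ q * (2 ^ (N - 1) * (1 ^ N + ‖x‖ ^ N)) := by gcongr
      _ = 2 ^ (N - 1) * (‖x‖ ^ 0 * q + ‖x‖ ^ N * q) := by ring
      _ ≤ _ := by gcongr
  refine ⟨_, ?_, hA⟩
  have := (norm_nonneg _).trans (hA 0)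
  simpa using this

end Decay

/-! ### Smoothness of the small-jump exponent -/

theorem norm_cexp_I_mul_sub_one_sub_le (x : ℝ) :
    ‖Complex.exp (Complex.I * x) - 1 - Complex.I * x‖ ≤ 2 * x ^ 2 := by
  have hn : ‖Complex.I * (x : ℂ)‖ = |x| := by simp
  rcases le_total |x| 1 with h | h
  · have := Complex.norm_exp_sub_one_sub_id_le (x := Complex.I * x) (by rwa [hn])
    rw [hn, sq_abs] at this
    nlinarith [sq_nonneg x]
  · have h1 := Real.norm_exp_I_mul_ofReal_sub_one_le (x := x)
    rw [Real.norm_eq_abs] at h1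
    have h2 := norm_sub_le (Complex.exp (Complex.I * x) - 1) (Complex.I * x)
    rw [hn] at h2
    nlinarith [sq_abs x]

section SmallJumps
variable {V : Type*} [NormedAddCommGroup V] [InnerProductSpace ℝ V]

/-- The real functional `⟪y, ·⟫` with values in `ℂ`. -/
noncomputable def innerCLM (y : V) : V →L[ℝ] ℂ := Complex.ofRealCLM.comp (innerSL ℝ y)

theorem innerCLM_apply (y v : V) : innerCLM y v = ((inner ℝ y v : ℝ) : ℂ) := rfl

theorem norm_innerCLM_le (y : V) : ‖innerCLM y‖ ≤ ‖y‖ := by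
  refine ContinuousLinearMap.opNorm_le_bound _ (norm_nonneg _) fun v => ?_
  rw [innerCLM_apply, Complex.norm_real]
  exact norm_inner_le_norm y v

theorem continuous_innerCLM : Continuous (innerCLM (V := V)) :=
  continuous_const.clm_comp (innerSL ℝ).continuous

variable (V) in
/-- `y ↦ (2πi)² ⟪y, ·⟫ ⊗ ⟪y, ·⟫`. -/
noncomputable def innerSqCLM (y : V) : V →L[ℝ] V →L[ℝ] ℂ :=
  (Complex.I * (-(2 * Real.pi) : ℝ)) ^ 2 • (innerSL ℝ y).smulRight (innerCLM y)

theorem continuous_innerSqCLM : Continuous (innerSqCLM V) := by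
  have h : Continuous fun y : V => (innerSL ℝ y).smulRight (innerCLM y) :=
    (ContinuousLinearMap.smulRightL ℝ V (V →L[ℝ] ℂ)).continuous₂.comp
      ((innerSL ℝ).continuous.prodMk continuous_innerCLM)
  exact h.const_smul ((Complex.I * (-(2 * Real.pi) : ℝ)) ^ 2)

theorem norm_smul_innerSqCLM_le (a : ℂ) (y : V) :
    ‖a • innerSqCLM V y‖ ≤ ‖a‖ * ((2 * Real.pi) ^ 2 * ‖y‖ ^ 2) := by
  refine ContinuousLinearMap.opNorm_le_bound _ (by positivity) fun w => ?_
  have e : (a • innerSqCLM V y) w =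
      (a * (Complex.I * (-(2 * Real.pi) : ℝ)) ^ 2 * (inner ℝ y w : ℝ)) • innerCLM y := by
    ext z
    simp only [innerSqCLM, ContinuousLinearMap.smulRight_apply, smul_apply, innerSL_apply_apply,
      smul_eq_mul, Complex.real_smul]
    ring
  rw [e, norm_smul, norm_mul, norm_mul, norm_pow, norm_mul, Complex.norm_I, one_mul,
    Complex.norm_real, Complex.norm_real, norm_neg, Real.norm_of_nonneg Real.two_pi_pos.le]
  calc _ ≤ ‖a‖ * (2 * Real.pi) ^ 2 * (‖y‖ * ‖w‖) * ‖y‖ := by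
        gcongr
        · exact norm_inner_le_norm y w
        · exact norm_innerCLM_le y
    _ = _ := by ring

theorem norm_innerSqCLM_le (y : V) : ‖innerSqCLM V y‖ ≤ (2 * Real.pi) ^ 2 * ‖y‖ ^ 2 := by
  simpa using norm_smul_innerSqCLM_le 1 y

/-- The exponent `y ↦ e^{iu} - 1 - iu` at `u = -2π⟪y, v⟫`. -/
noncomputable def compensatedExp (y v : V) : ℂ :=
  Complex.exp (Complex.I * ((-(2 * Real.pi) * inner ℝ y v : ℝ) : ℂ)) - 1 -
    Complex.I * ((-(2 * Real.pi) * inner ℝ y v : ℝ) : ℂ)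

/-- The derivative of `compensatedExp y`. -/
noncomputable def compensatedExpDeriv (y v : V) : V →L[ℝ] ℂ :=
  (Complex.I * (-(2 * Real.pi) : ℝ) *
    (Complex.exp (Complex.I * ((-(2 * Real.pi) * inner ℝ y v : ℝ) : ℂ)) - 1)) • innerCLM y

theorem abs_two_pi_mul_inner_le (y v : V) :
    |-(2 * Real.pi) * inner ℝ y v| ≤ 2 * Real.pi * (‖y‖ * ‖v‖) := by
  rw [abs_mul, abs_neg, abs_of_pos Real.two_pi_pos]
  gcongr
  exact abs_real_inner_le_norm y v

theorem norm_compensatedExp_le (y v : V) :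
    ‖compensatedExp y v‖ ≤ 2 * (2 * Real.pi * ‖v‖) ^ 2 * ‖y‖ ^ 2 := by
  refine (norm_cexp_I_mul_sub_one_sub_le _).trans ?_
  calc 2 * (-(2 * Real.pi) * inner ℝ y v) ^ 2 = 2 * |-(2 * Real.pi) * inner ℝ y v| ^ 2 := by
        rw [sq_abs]
    _ ≤ 2 * (2 * Real.pi * (‖y‖ * ‖v‖)) ^ 2 := by
        gcongr; exact abs_two_pi_mul_inner_le y v
    _ = _ := by ring

theorem norm_compensatedExpDeriv_le (y v : V) :
    ‖compensatedExpDeriv y v‖ ≤ (2 * Real.pi) ^ 2 * ‖v‖ * ‖y‖ ^ 2 := by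
  unfold compensatedExpDeriv
  rw [norm_smul, norm_mul, norm_mul, Complex.norm_I, one_mul, Complex.norm_real, norm_neg,
    Real.norm_of_nonneg Real.two_pi_pos.le]
  have h1 := Real.norm_exp_I_mul_ofReal_sub_one_le (x := -(2 * Real.pi) * inner ℝ y v)
  calc _ ≤ 2 * Real.pi * (2 * Real.pi * (‖y‖ * ‖v‖)) * ‖y‖ := by
        gcongr
        · exact h1.trans (abs_two_pi_mul_inner_le y v)
        · exact norm_innerCLM_le y
    _ = _ := by ring

theorem hasFDerivAt_cexp_inner (y v : V) :
    HasFDerivAt (fun v => Complex.exp (Complex.I * ((-(2 * Real.pi) * inner ℝ y v : ℝ) : ℂ)))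
      ((Complex.exp (Complex.I * ((-(2 * Real.pi) * inner ℝ y v : ℝ) : ℂ)) *
        (Complex.I * (-(2 * Real.pi) : ℝ))) • innerCLM y) v := by
  have h1 : HasFDerivAt (fun v => Complex.I * ((-(2 * Real.pi) * inner ℝ y v : ℝ) : ℂ))
      ((Complex.I * (-(2 * Real.pi) : ℝ)) • innerCLM y) v := by
    have := ((innerCLM y).hasFDerivAt (x := v)).const_mul (Complex.I * (-(2 * Real.pi) : ℝ))
    refine this.congr_of_eventuallyEq (.of_forall fun w => ?_)
    simp only [innerCLM_apply]
    push_cast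
    ring
  have := h1.cexp
  rwa [smul_smul] at this

theorem hasFDerivAt_compensatedExp (y v : V) :
    HasFDerivAt (compensatedExp y) (compensatedExpDeriv y v) v := by
  have h1 : HasFDerivAt (fun v => Complex.I * ((-(2 * Real.pi) * inner ℝ y v : ℝ) : ℂ))
      ((Complex.I * (-(2 * Real.pi) : ℝ)) • innerCLM y) v := by
    have := ((innerCLM y).hasFDerivAt (x := v)).const_mul (Complex.I * (-(2 * Real.pi) : ℝ))
    refine this.congr_of_eventuallyEq (.of_forall fun w => ?_)
    simp only [innerCLM_apply]
    push_cast
    ring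
  refine (((hasFDerivAt_cexp_inner y v).sub_const 1).sub h1).congr_fderiv ?_
  rw [compensatedExpDeriv, ← sub_smul]
  ring_nf

theorem hasFDerivAt_compensatedExpDeriv (y v : V) :
    HasFDerivAt (compensatedExpDeriv y)
      (Real.fourierChar (-inner ℝ y v) • innerSqCLM V y) v := by
  have h1 := ((((hasFDerivAt_cexp_inner y v).sub_const 1).const_mul
    (Complex.I * (-(2 * Real.pi) : ℝ))).smul_const (innerCLM y))
  refine h1.congr_fderiv ?_
  have e : (Real.fourierChar (-inner ℝ y v) : ℂ) =
      Complex.exp (Complex.I * ((-(2 * Real.pi) * inner ℝ y v : ℝ) : ℂ)) := by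
    rw [Real.fourierChar_apply]
    congr 1
    push_cast
    ring
  ext w z
  simp only [innerSqCLM, Circle.smul_def, e, ContinuousLinearMap.smulRight_apply,
    smul_apply, innerSL_apply_apply, innerCLM_apply, smul_eq_mul,
    Complex.real_smul]
  ring

theorem continuous_compensatedExp (v : V) : Continuous fun y => compensatedExp y v := by
  unfold compensatedExp
  fun_prop

theorem continuous_compensatedExpDeriv (v : V) : Continuous fun y => compensatedExpDeriv y v := by
  unfold compensatedExpDeriv
  have := continuous_innerCLM (V := V)
  fun_prop

variable [FiniteDimensional ℝ V] [MeasurableSpace V] [BorelSpace V] (κ : Measure V)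

omit [FiniteDimensional ℝ V] in
theorem integrable_compensatedExp (h2 : Integrable (fun y => ‖y‖ ^ 2) κ) (v : V) :
    Integrable (fun y => compensatedExp y v) κ :=
  (h2.const_mul _).mono' (continuous_compensatedExp v).aestronglyMeasurable
    (.of_forall fun y => norm_compensatedExp_le y v)

theorem integrable_compensatedExpDeriv (h2 : Integrable (fun y => ‖y‖ ^ 2) κ) (v : V) :
    Integrable (fun y => compensatedExpDeriv y v) κ :=
  (h2.const_mul _).mono' (continuous_compensatedExpDeriv v).aestronglyMeasurable
    (.of_forall fun y => norm_compensatedExpDeriv_le y v)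

theorem hasFDerivAt_integral_compensatedExp (h2 : Integrable (fun y => ‖y‖ ^ 2) κ) (v : V) :
    HasFDerivAt (fun v => ∫ y, compensatedExp y v ∂κ) (∫ y, compensatedExpDeriv y v ∂κ) v := by
  refine hasFDerivAt_integral_of_dominated_of_fderiv_le
    (bound := fun y => (2 * Real.pi) ^ 2 * (‖v‖ + 1) * ‖y‖ ^ 2)
    (F' := fun v y => compensatedExpDeriv y v)
    (Metric.ball_mem_nhds v one_pos)
    (.of_forall fun v => (continuous_compensatedExp v).aestronglyMeasurable)
    (integrable_compensatedExp κ h2 v)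
    (continuous_compensatedExpDeriv v).aestronglyMeasurable
    (.of_forall fun y w hw => ?_) (h2.const_mul _)
    (.of_forall fun y w _ => hasFDerivAt_compensatedExp y w)
  refine (norm_compensatedExpDeriv_le y w).trans ?_
  have : ‖w‖ ≤ ‖v‖ + 1 := by
    have h3 := norm_sub_norm_le w v
    rw [mem_ball_iff_norm] at hw
    linarith
  gcongr

/-- Only `|y|^2` is assumed integrable, so the compensated integral is differentiated twice by hand.
The second derivative no longer carries a compensator: it is a Fourier integral of the quadratic
weight `innerSqCLM`, to which the general theory applies. -/
theorem hasFDerivAt_integral_compensatedExpDeriv (h2 : Integrable (fun y => ‖y‖ ^ 2) κ) (v : V) :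
    HasFDerivAt (fun v => ∫ y, compensatedExpDeriv y v ∂κ)
      (VectorFourier.fourierIntegral Real.fourierChar κ (innerSL ℝ).toLinearMap₁₂ (innerSqCLM V) v)
      v := by
  refine hasFDerivAt_integral_of_dominated_of_fderiv_le
    (bound := fun y => (2 * Real.pi) ^ 2 * ‖y‖ ^ 2)
    (F' := fun v y => Real.fourierChar (-inner ℝ y v) • innerSqCLM V y)
    (Metric.ball_mem_nhds v one_pos)
    (.of_forall fun v => (continuous_compensatedExpDeriv v).aestronglyMeasurable)
    (integrable_compensatedExpDeriv κ h2 v) ?_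
    (.of_forall fun y w hw => ?_) (h2.const_mul _)
    (.of_forall fun y w _ => hasFDerivAt_compensatedExpDeriv y w)
  · refine Continuous.aestronglyMeasurable ?_
    have := continuous_innerSqCLM (V := V)
    fun_prop
  · have := norm_smul_innerSqCLM_le (Real.fourierChar (-inner ℝ y w) : ℂ) y
    rw [Circle.norm_coe, one_mul] at this
    exact this

variable {κ}

omit [FiniteDimensional ℝ V] in
theorem integrable_pow_mul_innerSqCLM (h2 : Integrable (fun y => ‖y‖ ^ 2) κ)
    (h1 : ∀ᵐ y ∂κ, ‖y‖ ≤ 1) (n : ℕ) :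
    Integrable (fun y => ‖y‖ ^ n * ‖innerSqCLM V y‖) κ := by
  refine (h2.const_mul ((2 * Real.pi) ^ 2)).mono' ?_ ?_
  · have hc : Continuous fun y : V => ‖innerSqCLM V y‖ := by
      refine (@continuous_norm (V →L[ℝ] V →L[ℝ] ℂ) _).comp ?_
      exact continuous_innerSqCLM
    exact ((continuous_norm.pow n).mul hc).aestronglyMeasurable
  · filter_upwards [h1] with y hy
    refine (Real.norm_of_nonneg (by positivity)).trans_le ?_
    exact (mul_le_mul (pow_le_one₀ (norm_nonneg _) hy) (norm_innerSqCLM_le y)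
      (ContinuousLinearMap.opNorm_nonneg _) zero_le_one).trans_eq (one_mul _)

theorem aestronglyMeasurable_innerSqCLM : AEStronglyMeasurable (innerSqCLM V) κ := by
  refine Continuous.aestronglyMeasurable ?_
  exact continuous_innerSqCLM

theorem fderiv_fderiv_integral_compensatedExp (h2 : Integrable (fun y => ‖y‖ ^ 2) κ) :
    fderiv ℝ (fderiv ℝ (fun v => ∫ y, compensatedExp y v ∂κ)) =
      VectorFourier.fourierIntegral Real.fourierChar κ (innerSL ℝ).toLinearMap₁₂
        (innerSqCLM V) := by
  have e1 : fderiv ℝ (fun v => ∫ y, compensatedExp y v ∂κ) =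
      fun v => ∫ y, compensatedExpDeriv y v ∂κ :=
    funext fun v => (hasFDerivAt_integral_compensatedExp κ h2 v).fderiv
  rw [e1]
  exact funext fun v => (hasFDerivAt_integral_compensatedExpDeriv κ h2 v).fderiv

theorem contDiff_integral_compensatedExp (h2 : Integrable (fun y => ‖y‖ ^ 2) κ)
    (h1 : ∀ᵐ y ∂κ, ‖y‖ ≤ 1) :
    ContDiff ℝ ∞ (fun v => ∫ y, compensatedExp y v ∂κ) := by
  have e1 : fderiv ℝ (fun v => ∫ y, compensatedExp y v ∂κ) =
      fun v => ∫ y, compensatedExpDeriv y v ∂κ :=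
    funext fun v => (hasFDerivAt_integral_compensatedExp κ h2 v).fderiv
  rw [contDiff_infty_iff_fderiv, contDiff_infty_iff_fderiv, fderiv_fderiv_integral_compensatedExp h2,
    e1]
  refine ⟨fun v => (hasFDerivAt_integral_compensatedExp κ h2 v).differentiableAt,
    fun v => (hasFDerivAt_integral_compensatedExpDeriv κ h2 v).differentiableAt, ?_⟩
  exact VectorFourier.contDiff_fourierIntegral (N := ⊤) _
    fun n _ => integrable_pow_mul_innerSqCLM h2 h1 n

/-- The first derivative grows linearly, from `|e^{iu} - 1| ≤ |u|`. Higher ones are bounded, being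
derivatives of a Fourier integral whose weight has all moments finite. -/
theorem exists_norm_iteratedFDeriv_integral_compensatedExp_le
    (h2 : Integrable (fun y => ‖y‖ ^ 2) κ) (h1 : ∀ᵐ y ∂κ, ‖y‖ ≤ 1) (n : ℕ) (hn : 1 ≤ n) :
    ∃ C, ∀ v, ‖iteratedFDeriv ℝ n (fun v => ∫ y, compensatedExp y v ∂κ) v‖ ≤ C * (1 + ‖v‖) := by
  obtain ⟨n, rfl⟩ := Nat.exists_eq_add_of_le' hn
  rcases n with _ | n
  · refine ⟨∫ y, (2 * Real.pi) ^ 2 * ‖y‖ ^ 2 ∂κ, fun v => ?_⟩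
    rw [zero_add, ← norm_iteratedFDeriv_fderiv, norm_iteratedFDeriv_zero,
      (hasFDerivAt_integral_compensatedExp κ h2 v).fderiv]
    have h3 : ‖∫ y, compensatedExpDeriv y v ∂κ‖ ≤ ∫ y, (2 * Real.pi) ^ 2 * ‖v‖ * ‖y‖ ^ 2 ∂κ :=
      norm_integral_le_of_norm_le (h2.const_mul _)
        (.of_forall fun y => norm_compensatedExpDeriv_le y v)
    refine h3.trans ?_
    rw [integral_const_mul, integral_const_mul]
    have h4 : 0 ≤ ∫ y, ‖y‖ ^ 2 ∂κ := integral_nonneg fun y => by positivity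
    have h5 : 0 ≤ (2 * Real.pi) ^ 2 * ∫ y, ‖y‖ ^ 2 ∂κ := by positivity
    nlinarith
  · set C := ∫ y, ‖VectorFourier.fourierPowSMulRight (innerSL ℝ) (innerSqCLM V) y n‖ ∂κ
    have hC : 0 ≤ C := integral_nonneg fun y => norm_nonneg _
    refine ⟨C, fun v => ?_⟩
    rw [← norm_iteratedFDeriv_fderiv, ← norm_iteratedFDeriv_fderiv,
      fderiv_fderiv_integral_compensatedExp h2,
      VectorFourier.iteratedFDeriv_fourierIntegral (N := ⊤) _
        (fun n _ => integrable_pow_mul_innerSqCLM h2 h1 n)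
        aestronglyMeasurable_innerSqCLM le_top]
    refine (VectorFourier.norm_fourierIntegral_le_integral_norm _ _ _ _ _).trans ?_
    have := norm_nonneg v
    nlinarith

theorem exists_forall_norm_iteratedFDeriv_le (h2 : Integrable (fun y => ‖y‖ ^ 2) κ)
    (h1 : ∀ᵐ y ∂κ, ‖y‖ ≤ 1) (b : V →L[ℝ] ℂ) (N : ℕ) :
    ∃ C, ∀ n, 1 ≤ n → n ≤ N → ∀ v,
      ‖iteratedFDeriv ℝ n (fun v => (∫ y, compensatedExp y v ∂κ) + b v) v‖ ≤ C * (1 + ‖v‖) := by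
  have hone : ∀ n, 1 ≤ n → ∃ C, ∀ v,
      ‖iteratedFDeriv ℝ n (fun v => (∫ y, compensatedExp y v ∂κ) + b v) v‖ ≤ C * (1 + ‖v‖) := by
    intro n hn
    obtain ⟨C, hC⟩ := exists_norm_iteratedFDeriv_integral_compensatedExp_le h2 h1 n hn
    refine ⟨C + ‖b‖, fun v => ?_⟩
    have e : iteratedFDeriv ℝ n (fun v => (∫ y, compensatedExp y v ∂κ) + b v) v =
        iteratedFDeriv ℝ n (fun v => ∫ y, compensatedExp y v ∂κ) v + iteratedFDeriv ℝ n b v :=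
      iteratedFDeriv_add_apply
        (((contDiff_integral_compensatedExp h2 h1).of_le (by exact_mod_cast le_top)).contDiffAt)
        (b.contDiff.contDiffAt)
    have hb : ‖iteratedFDeriv ℝ n b v‖ ≤ ‖b‖ := by
      obtain ⟨n, rfl⟩ := Nat.exists_eq_add_of_le' hn
      rw [← norm_iteratedFDeriv_fderiv]
      have : fderiv ℝ b = fun _ => b := funext fun v => b.fderiv
      rw [this]
      rcases n with _ | n
      · simp
      · rw [iteratedFDeriv_const_of_ne (by omega)]
        simp
    rw [e]
    have h3 := hC v
    have h4 := norm_nonneg v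
    have h5 := norm_nonneg b
    refine (norm_add_le _ _).trans ?_
    nlinarith
  choose! C hC using hone
  refine ⟨∑ n ∈ Finset.Icc 1 N, |C n|, fun n hn hN v => (hC n hn v).trans ?_⟩
  have := norm_nonneg v
  gcongr
  exact (le_abs_self _).trans (Finset.single_le_sum (f := fun n => |C n|)
    (fun i _ => abs_nonneg _) (Finset.mem_Icc.2 ⟨hn, hN⟩))

end SmallJumps

/-! ### The stable Lévy measure in polar coordinates -/

section StableLevyMeasure

/-- The radial part `s^(-1-α) ds` on `(0, ∞)` of a stable Lévy measure. -/
noncomputable def radialMeasure (α : ℝ) : Measure ℝ :=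
  ((volume : Measure ℝ).restrict (Set.Ioi 0)).withDensity (fun s => ENNReal.ofReal (s ^ (-1 - α)))

instance (α : ℝ) : SFinite (radialMeasure α) := by unfold radialMeasure; infer_instance

theorem measurable_radialDensity (α : ℝ) :
    Measurable (fun s : ℝ => ENNReal.ofReal (s ^ (-1 - α))) := by fun_prop

theorem ae_radialMeasure_pos (α : ℝ) : ∀ᵐ s ∂(radialMeasure α), 0 < s :=
  (withDensity_absolutelyContinuous _ _).ae_le (ae_restrict_mem measurableSet_Ioi)

theorem integral_radialMeasure {E : Type*} [NormedAddCommGroup E] [NormedSpace ℝ E] (α : ℝ)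
    (f : ℝ → E) :
    ∫ s, f s ∂(radialMeasure α) = ∫ s in Set.Ioi 0, s ^ (-1 - α) • f s := by
  rw [radialMeasure, integral_withDensity_eq_integral_toReal_smul (measurable_radialDensity α)
    (.of_forall fun s => ENNReal.ofReal_lt_top)]
  refine setIntegral_congr_fun measurableSet_Ioi fun s hs => ?_
  rw [ENNReal.toReal_ofReal (Real.rpow_nonneg (le_of_lt hs) _)]

theorem integrable_radialMeasure_iff (α : ℝ) (f : ℝ → ℝ) :
    Integrable f (radialMeasure α) ↔ IntegrableOn (fun s => s ^ (-1 - α) * f s) (Set.Ioi 0) := by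
  rw [radialMeasure, integrable_withDensity_iff_integrable_smul' (measurable_radialDensity α)
    (.of_forall fun s => ENNReal.ofReal_lt_top)]
  refine integrableOn_congr_fun (fun s hs => ?_) measurableSet_Ioi
  simp only [smul_eq_mul]
  rw [ENNReal.toReal_ofReal (Real.rpow_nonneg (le_of_lt hs) _)]

variable {d : ℕ} (α : ℝ) (μ : Measure (Metric.sphere (0 : EuclideanSpace ℝ (Fin d)) 1))

theorem measurable_smul_sphere : Measurable
    (fun z : ℝ × Metric.sphere (0 : EuclideanSpace ℝ (Fin d)) 1 =>
      z.1 • (z.2 : EuclideanSpace ℝ (Fin d))) := by fun_prop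

theorem stableLevyMeasure_eq_map : stableLevyMeasure α μ = ((radialMeasure α).prod μ).map
    (fun z => z.1 • (z.2 : EuclideanSpace ℝ (Fin d))) := rfl

theorem norm_smul_sphere {s : ℝ} (hs : 0 < s)
    (θ : Metric.sphere (0 : EuclideanSpace ℝ (Fin d)) 1) :
    ‖s • (θ : EuclideanSpace ℝ (Fin d))‖ = s := by
  rw [norm_smul, norm_eq_of_mem_sphere, mul_one, Real.norm_of_nonneg hs.le]

theorem ae_prod_radialMeasure_pos : ∀ᵐ z ∂((radialMeasure α).prod μ), 0 < z.1 :=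
  Measure.quasiMeasurePreserving_fst.ae (ae_radialMeasure_pos α)

variable [IsFiniteMeasure μ]

/-- Separation of variables in polar coordinates. No integrability is asked: the product formula for
integrals holds without it. -/
theorem integral_stableLevyMeasure {E : Type*} [NormedAddCommGroup E] [NormedSpace ℝ E]
    {F : EuclideanSpace ℝ (Fin d) → E} (hF : AEStronglyMeasurable F (stableLevyMeasure α μ))
    (φ : ℝ → ℝ) (g : Metric.sphere (0 : EuclideanSpace ℝ (Fin d)) 1 → E)
    (h : ∀ s, 0 < s → ∀ θ : Metric.sphere (0 : EuclideanSpace ℝ (Fin d)) 1,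
      F (s • (θ : EuclideanSpace ℝ (Fin d))) = φ s • g θ) :
    ∫ y, F y ∂(stableLevyMeasure α μ) =
      (∫ s in Set.Ioi 0, s ^ (-1 - α) * φ s) • ∫ θ, g θ ∂μ := by
  rw [stableLevyMeasure_eq_map] at hF ⊢
  rw [integral_map measurable_smul_sphere.aemeasurable hF]
  have h1 := integral_radialMeasure α φ
  simp only [smul_eq_mul] at h1
  rw [← h1, ← integral_prod_smul]
  refine integral_congr_ae ?_
  filter_upwards [ae_prod_radialMeasure_pos α μ] with z hz
  exact h _ hz _

theorem integrable_stableLevyMeasure {E : Type*} [NormedAddCommGroup E]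
    {F : EuclideanSpace ℝ (Fin d) → E} (hF : AEStronglyMeasurable F (stableLevyMeasure α μ))
    {φ : ℝ → ℝ} (hφ : IntegrableOn (fun s => s ^ (-1 - α) * φ s) (Set.Ioi 0))
    (h : ∀ s, 0 < s → ∀ θ : Metric.sphere (0 : EuclideanSpace ℝ (Fin d)) 1,
      ‖F (s • (θ : EuclideanSpace ℝ (Fin d)))‖ ≤ φ s) :
    Integrable F (stableLevyMeasure α μ) := by
  rw [stableLevyMeasure_eq_map] at hF ⊢
  rw [integrable_map_measure hF measurable_smul_sphere.aemeasurable]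
  have h1 := ((integrable_radialMeasure_iff α φ).2 hφ).comp_fst μ
  refine h1.mono' (hF.comp_measurable measurable_smul_sphere) ?_
  filter_upwards [ae_prod_radialMeasure_pos α μ] with z hz
  exact h _ hz _

variable {α}

theorem integrableOn_sq_norm_stableLevyMeasure (hα2 : α < 2) :
    IntegrableOn (fun y => ‖y‖ ^ 2) (Metric.ball 0 1) (stableLevyMeasure α μ) := by
  rw [← integrable_indicator_iff measurableSet_ball]
  refine integrable_stableLevyMeasure α μ (φ := (Set.Iio 1).indicator fun s => s ^ 2) ?_ ?_ ?_
  · exact ((measurable_norm.pow_const 2).indicator measurableSet_ball).aestronglyMeasurable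
  · have e : (fun s : ℝ => s ^ (-1 - α) * (Set.Iio 1).indicator (fun s => s ^ 2) s) =
        (Set.Iio 1).indicator (fun s => s ^ (-1 - α) * s ^ 2) := by
      ext s; by_cases hs : s ∈ Set.Iio (1 : ℝ) <;> simp [hs]
    rw [e, integrableOn_indicator_iff measurableSet_Iio, Set.Iio_inter_Ioi]
    have h1 : IntegrableOn (fun s : ℝ => s ^ (1 - α)) (Set.Ioo 0 1) := by
      rw [← integrableOn_Ioc_iff_integrableOn_Ioo, ← intervalIntegrable_iff_integrableOn_Ioc_of_le
        zero_le_one]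
      exact intervalIntegral.intervalIntegrable_rpow' (by linarith)
    refine h1.congr_fun (fun s hs => ?_) measurableSet_Ioo
    simp only
    rw [← Real.rpow_natCast s 2, ← Real.rpow_add hs.1]
    norm_num
    ring_nf
  · intro s hs θ
    by_cases h : s < 1
    · rw [Set.indicator_of_mem (by simpa [norm_smul_sphere hs] using h),
        Set.indicator_of_mem (by exact h), norm_smul_sphere hs]
      simp
    · rw [Set.indicator_of_notMem (by simpa [norm_smul_sphere hs] using h),
        Set.indicator_of_notMem (by exact h)]
      simp

theorem stableLevyMeasure_compl_ball_lt_top (hα0 : 0 < α) :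
    stableLevyMeasure α μ (Metric.ball 0 1)ᶜ < ⊤ := by
  have hm : MeasurableSet (Metric.ball (0 : EuclideanSpace ℝ (Fin d)) 1)ᶜ :=
    measurableSet_ball.compl
  have : Integrable ((Metric.ball (0 : EuclideanSpace ℝ (Fin d)) 1)ᶜ.indicator fun _ => (1 : ℝ))
      (stableLevyMeasure α μ) := by
    refine integrable_stableLevyMeasure α μ (φ := (Set.Ici 1).indicator fun s => 1) ?_ ?_ ?_
    · exact (measurable_const.indicator hm).aestronglyMeasurable
    · have e : (fun s : ℝ => s ^ (-1 - α) * (Set.Ici 1).indicator (fun s => 1) s) =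
          (Set.Ici 1).indicator (fun s => s ^ (-1 - α)) := by
        ext s; by_cases hs : s ∈ Set.Ici (1 : ℝ) <;> simp [hs]
      rw [e, integrableOn_indicator_iff measurableSet_Ici]
      refine IntegrableOn.mono_set ?_ Set.inter_subset_left
      rw [integrableOn_Ici_iff_integrableOn_Ioi]
      exact integrableOn_Ioi_rpow_of_lt (by linarith) zero_lt_one
    · intro s hs θ
      by_cases h : 1 ≤ s
      · rw [Set.indicator_of_mem (by simpa [norm_smul_sphere hs] using h),
          Set.indicator_of_mem (by exact h)]
        simp
      · rw [Set.indicator_of_notMem (by simpa [norm_smul_sphere hs] using h),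
          Set.indicator_of_notMem (by exact h)]
        simp
  rw [integrable_indicator_iff hm] at this
  simpa [integrableOn_const_iff] using this

theorem radialMeasure_le (α : ℝ) (hα0 : 0 < α) {R r : ℝ} (hR : 0 < R) (a : ℝ) :
    radialMeasure α {s | R ≤ s ∧ |s - a| < r} ≤
      ENNReal.ofReal (R ^ (-1 - α)) * ENNReal.ofReal (2 * r) := by
  have hm : MeasurableSet {s : ℝ | R ≤ s ∧ |s - a| < r} :=
    (measurableSet_le measurable_const measurable_id).inter
      (measurableSet_lt (by fun_prop : Measurable fun s : ℝ => |s - a|) measurable_const)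
  rw [radialMeasure, withDensity_apply _ hm, Measure.restrict_restrict hm]
  calc _ ≤ ∫⁻ s in {s | R ≤ s ∧ |s - a| < r} ∩ Set.Ioi 0, ENNReal.ofReal (R ^ (-1 - α)) := by
        refine setLIntegral_mono measurable_const fun s hs => ?_
        exact ENNReal.ofReal_le_ofReal (Real.rpow_le_rpow_of_nonpos hR hs.1.1 (by linarith))
    _ = ENNReal.ofReal (R ^ (-1 - α)) * volume ({s | R ≤ s ∧ |s - a| < r} ∩ Set.Ioi 0) :=
        setLIntegral_const _ _
    _ ≤ ENNReal.ofReal (R ^ (-1 - α)) * volume (Metric.ball a r) := by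
        gcongr
        intro s hs
        simpa [Real.dist_eq] using hs.1.2
    _ = _ := by rw [Real.volume_ball]

/-- The origin is included, with an arbitrary direction, so that later arguments need no case split
on `w`; this is where `d > 0` enters. -/
theorem exists_sphere_smul_eq (hd : 0 < d) (w : EuclideanSpace ℝ (Fin d)) :
    ∃ θ : Metric.sphere (0 : EuclideanSpace ℝ (Fin d)) 1,
      w = ‖w‖ • (θ : EuclideanSpace ℝ (Fin d)) := by
  rcases eq_or_ne w 0 with rfl | hw
  · have : Nonempty (Fin d) := ⟨⟨0, hd⟩⟩
    have : Nontrivial (EuclideanSpace ℝ (Fin d)) := inferInstance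
    obtain ⟨θ, hθ⟩ := NormedSpace.sphere_nonempty (E := EuclideanSpace ℝ (Fin d))
      (x := 0) (r := 1) |>.2 zero_le_one
    exact ⟨⟨θ, hθ⟩, by simp⟩
  · have hn : ‖w‖ ≠ 0 := norm_ne_zero_iff.2 hw
    refine ⟨⟨‖w‖⁻¹ • w, ?_⟩, ?_⟩
    · rw [mem_sphere_zero_iff_norm, norm_smul, norm_inv, norm_norm, inv_mul_cancel₀ hn]
    · rw [smul_smul, mul_inv_cancel₀ hn, one_smul]

/-- In polar coordinates the set lies in a product: a radial interval of length `2r` on which the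
density is at most `R^(-1-α)`, and a spherical ball of radius `2r/R`, of measure at most a multiple
of `(r/R)^(γ-1)`. -/
theorem exists_stableLevyMeasure_ball_inter_le (hα0 : 0 < α) (hd : 0 < d) {γ : ℝ}
    (hμγ : IsSphereKappaMeasure μ (γ - 1)) :
    ∃ C, 0 ≤ C ∧ ∀ (w : EuclideanSpace ℝ (Fin d)) (r R : ℝ), 0 < r → 0 < R →
      stableLevyMeasure α μ (Metric.ball w r ∩ {y | R ≤ ‖y‖}) ≤
        ENNReal.ofReal (C * r ^ γ * R ^ (-(γ + α))) := by
  obtain ⟨c, hc⟩ := hμγ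
  refine ⟨2 * |c| * 2 ^ (γ - 1), by positivity, fun w r R hr hR => ?_⟩
  obtain ⟨θ₀, hθ₀⟩ := exists_sphere_smul_eq hd w
  have hm : MeasurableSet (Metric.ball w r ∩ {y | R ≤ ‖y‖}) :=
    measurableSet_ball.inter (measurableSet_le measurable_const measurable_norm)
  rw [stableLevyMeasure_eq_map, Measure.map_apply measurable_smul_sphere hm]
  calc _ ≤ ((radialMeasure α).prod μ)
          ({s | R ≤ s ∧ |s - ‖w‖| < r} ×ˢ Metric.ball θ₀ (2 * r / R)) := by
        refine measure_mono_ae ?_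
        filter_upwards [ae_prod_radialMeasure_pos α μ] with z hz hzm
        obtain ⟨h1, h2⟩ := hzm
        change R ≤ ‖z.1 • (z.2 : EuclideanSpace ℝ (Fin d))‖ at h2
        rw [norm_smul_sphere hz] at h2
        rw [mem_ball_iff_norm] at h1
        have h3 : |z.1 - ‖w‖| < r := by
          have := abs_norm_sub_norm_le (z.1 • (z.2 : EuclideanSpace ℝ (Fin d))) w
          rw [norm_smul_sphere hz] at this
          exact this.trans_lt h1
        refine ⟨⟨h2, h3⟩, ?_⟩
        rw [Metric.mem_ball, Subtype.dist_eq, dist_eq_norm, lt_div_iff₀ hR]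
        -- Replacing `w = |w|θ₀` by `sθ₀` costs another `r`, since `|s - |w|| < r`; hence `s|θ - θ₀|
        -- < 2r`, and `s ≥ R`.
        have e : z.1 • ((z.2 : EuclideanSpace ℝ (Fin d)) - θ₀) =
            (z.1 • (z.2 : EuclideanSpace ℝ (Fin d)) - w) +
              (‖w‖ - z.1) • (θ₀ : EuclideanSpace ℝ (Fin d)) := by
          nth_rewrite 1 [hθ₀]
          module
        have h4 : z.1 * ‖(z.2 : EuclideanSpace ℝ (Fin d)) - θ₀‖ < 2 * r := by
          calc z.1 * ‖(z.2 : EuclideanSpace ℝ (Fin d)) - θ₀‖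
              = ‖z.1 • ((z.2 : EuclideanSpace ℝ (Fin d)) - θ₀)‖ := by
                rw [norm_smul, Real.norm_of_nonneg hz.le]
            _ ≤ ‖z.1 • (z.2 : EuclideanSpace ℝ (Fin d)) - w‖ +
                ‖(‖w‖ - z.1) • (θ₀ : EuclideanSpace ℝ (Fin d))‖ := by
                rw [e]; exact norm_add_le _ _
            _ < r + r := by
                rw [norm_smul, norm_eq_of_mem_sphere, mul_one, Real.norm_eq_abs, abs_sub_comm]
                exact add_lt_add h1 h3
            _ = 2 * r := by ring
        calc _ ≤ z.1 * ‖(z.2 : EuclideanSpace ℝ (Fin d)) - θ₀‖ := by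
              rw [mul_comm]; gcongr
          _ < 2 * r := h4
    _ ≤ (ENNReal.ofReal (R ^ (-1 - α)) * ENNReal.ofReal (2 * r)) *
          ENNReal.ofReal (|c| * (2 * r / R) ^ (γ - 1)) := by
        rw [Measure.prod_prod]
        gcongr
        · exact radialMeasure_le α hα0 hR _
        · refine (hc θ₀ _ (by positivity)).trans (ENNReal.ofReal_le_ofReal ?_)
          gcongr
          exact le_abs_self c
    _ = _ := by
        rw [← ENNReal.ofReal_mul (by positivity), ← ENNReal.ofReal_mul (by positivity)]
        congr 1
        rw [Real.div_rpow (by positivity) hR.le, Real.mul_rpow zero_le_two hr.le, div_eq_mul_inv,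
          ← Real.rpow_neg hR.le]
        have e1 : r ^ γ = r * r ^ (γ - 1) := by
          rw [Real.rpow_sub_one hr.ne']; field_simp
        have e2 : R ^ (-(γ + α)) = R ^ (-1 - α) * R ^ (-(γ - 1)) := by
          rw [← Real.rpow_add hR]; ring_nf
        rw [e1, e2]
        ring

end StableLevyMeasure

/-! ### Tail integrals and the lower bound from nondegeneracy -/

section StableLevyMeasureEstimates
variable {d : ℕ} {α : ℝ} (μ : Measure (Metric.sphere (0 : EuclideanSpace ℝ (Fin d)) 1))

/-- The integrand is dominated by a sum over balls of radius `k + 1` about `z`, with `k = ⌊|z - y|⌋`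
the relevant index. Each contributes at most a multiple of `(k+1)^(γ-N) R^(-γ-α)`, summable because
`N ≥ γ + 2`. -/
theorem exists_lintegral_decay_stableLevyMeasure_le {γ : ℝ} {C : ℝ} (hC0 : 0 ≤ C)
    (hC : ∀ (w : EuclideanSpace ℝ (Fin d)) (r R : ℝ), 0 < r → 0 < R →
      stableLevyMeasure α μ (Metric.ball w r ∩ {y | R ≤ ‖y‖}) ≤
        ENNReal.ofReal (C * r ^ γ * R ^ (-(γ + α))))
    {N : ℕ} (hN : γ + 2 ≤ N) {A : ℝ} (hA : 0 ≤ A) {q : EuclideanSpace ℝ (Fin d) → ℂ}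
    (hq : ∀ x, ‖q x‖ ≤ A * ((1 + ‖x‖) ^ N)⁻¹) :
    ∃ D, 0 ≤ D ∧ ∀ z R, 0 < R → ∫⁻ y in {y | R ≤ ‖y‖}, ‖q (z - y)‖ₑ ∂(stableLevyMeasure α μ)
      ≤ ENNReal.ofReal (D * R ^ (-(γ + α))) := by
  have hsum : Summable fun k : ℕ => ((k + 1 : ℝ) ^ 2)⁻¹ := by
    have := (summable_nat_add_iff 1).2 (Real.summable_nat_pow_inv.2 one_lt_two)
    simpa using this
  refine ⟨A * C * ∑' k : ℕ, ((k + 1 : ℝ) ^ 2)⁻¹, by positivity, fun z R hR => ?_⟩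
  set T : Set (EuclideanSpace ℝ (Fin d)) := {y | R ≤ ‖y‖} with hT
  have hTm : MeasurableSet T := measurableSet_le measurable_const measurable_norm
  have hRs : 0 ≤ R ^ (-(γ + α)) := Real.rpow_nonneg hR.le _
  calc _ ≤ ∫⁻ y in T, ∑' k : ℕ, (Metric.ball z (k + 1)).indicator
          (fun _ => ENNReal.ofReal (A * (((k : ℝ) + 1) ^ N)⁻¹)) y ∂(stableLevyMeasure α μ) := by
        refine lintegral_mono fun y => ?_
        set k := ⌊‖z - y‖⌋₊
        have h1 : ‖z - y‖ < k + 1 := Nat.lt_floor_add_one _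
        have h2 : (k : ℝ) ≤ ‖z - y‖ := Nat.floor_le (norm_nonneg _)
        refine le_trans ?_ (ENNReal.le_tsum k)
        rw [Set.indicator_of_mem (by rwa [mem_ball_iff_norm, norm_sub_rev]), ← ofReal_norm]
        refine ENNReal.ofReal_le_ofReal ((hq _).trans ?_)
        gcongr A * (?_ ^ N)⁻¹
        linarith
    _ = ∑' k : ℕ, ENNReal.ofReal (A * (((k : ℝ) + 1) ^ N)⁻¹) *
          stableLevyMeasure α μ (Metric.ball z (k + 1) ∩ T) := by
        rw [lintegral_tsum fun k => (measurable_const.indicator measurableSet_ball).aemeasurable]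
        congr 1 with k
        rw [lintegral_indicator_const measurableSet_ball, Measure.restrict_apply measurableSet_ball]
    _ ≤ ∑' k : ℕ, ENNReal.ofReal (A * C * R ^ (-(γ + α)) * (((k : ℝ) + 1) ^ 2)⁻¹) := by
        refine ENNReal.tsum_le_tsum fun k => ?_
        have hk : (1 : ℝ) ≤ k + 1 := by linarith [Nat.cast_nonneg (α := ℝ) k]
        refine (mul_le_mul_right (hC z (k + 1) R (by positivity) hR) _).trans ?_
        rw [← ENNReal.ofReal_mul (by positivity)]
        refine ENNReal.ofReal_le_ofReal ?_
        have h3 : ((k : ℝ) + 1) ^ γ ≤ (k + 1) ^ N * (((k : ℝ) + 1) ^ 2)⁻¹ := by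
          rw [← div_eq_mul_inv, le_div_iff₀ (by positivity), ← Real.rpow_natCast, ← Real.rpow_natCast,
            ← Real.rpow_add (by positivity)]
          exact Real.rpow_le_rpow_of_exponent_le hk (by exact_mod_cast hN)
        calc _ ≤ A * (((k : ℝ) + 1) ^ N)⁻¹ *
              (C * ((k + 1) ^ N * (((k : ℝ) + 1) ^ 2)⁻¹) * R ^ (-(γ + α))) := by gcongr
          _ = _ := by field_simp
    _ = _ := by
        rw [← ENNReal.ofReal_tsum_of_nonneg (fun k => by positivity) (hsum.mul_left _),
          tsum_mul_left]
        congr 1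
        ring

variable [IsFiniteMeasure μ]

theorem continuous_integral_inner_sq :
    Continuous fun v : EuclideanSpace ℝ (Fin d) =>
      ∫ θ : Metric.sphere (0 : EuclideanSpace ℝ (Fin d)) 1, (inner ℝ (θ : EuclideanSpace ℝ (Fin d)) v) ^ 2 ∂μ := by
  have := continuous_parametric_integral_of_continuous (μ := μ)
    (f := fun (v : EuclideanSpace ℝ (Fin d)) (θ : Metric.sphere (0 : EuclideanSpace ℝ (Fin d)) 1) =>
      (inner ℝ (θ : EuclideanSpace ℝ (Fin d)) v) ^ 2)
    (by simp only [Function.uncurry_def]; fun_prop) isCompact_univ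
  simpa using this

/-- If the integral vanished, `μ`-almost every `θ` would be orthogonal to `v`, and the support would
lie in the closed proper subspace `v^⊥`. -/
theorem integral_inner_sq_pos (hμ : IsNondegenerate (μ.map Subtype.val))
    {v : EuclideanSpace ℝ (Fin d)} (hv : v ≠ 0) :
    0 < ∫ θ : Metric.sphere (0 : EuclideanSpace ℝ (Fin d)) 1,
      (inner ℝ (θ : EuclideanSpace ℝ (Fin d)) v) ^ 2 ∂μ := by
  refine lt_of_le_of_ne (integral_nonneg fun θ => sq_nonneg _) fun h0 => hμ ?_
  have hc : Continuous fun θ : Metric.sphere (0 : EuclideanSpace ℝ (Fin d)) 1 =>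
      (inner ℝ (θ : EuclideanSpace ℝ (Fin d)) v) ^ 2 := by fun_prop
  have h1 := (integral_eq_zero_iff_of_nonneg (fun θ => sq_nonneg _)
    (hc.integrable_of_hasCompactSupport (HasCompactSupport.of_compactSpace _))).1 h0.symm
  refine ⟨(ℝ ∙ v)ᗮ, fun htop => hv ?_, Measure.support_subset_of_isClosed
    (Submodule.isClosed_orthogonal _) ?_⟩
  · have : v ∈ (ℝ ∙ v)ᗮ := htop ▸ Submodule.mem_top
    rwa [Submodule.mem_orthogonal_singleton_iff_inner_right, inner_self_eq_zero] at this
  · refine (ae_map_iff (p := fun x => x ∈ (((ℝ ∙ v)ᗮ : Submodule ℝ _) : Set (EuclideanSpace ℝ (Fin d)))) measurable_subtype_coe.aemeasurable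
      (Submodule.isClosed_orthogonal _).measurableSet).2 ?_
    filter_upwards [h1] with θ hθ
    rw [SetLike.mem_coe, Submodule.mem_orthogonal_singleton_iff_inner_left]
    exact pow_eq_zero_iff two_ne_zero |>.1 hθ

theorem exists_le_integral_inner_sq (hd : 0 < d) (hμ : IsNondegenerate (μ.map Subtype.val)) :
    ∃ c, 0 < c ∧ ∀ v : EuclideanSpace ℝ (Fin d), c * ‖v‖ ^ 2 ≤
      ∫ θ : Metric.sphere (0 : EuclideanSpace ℝ (Fin d)) 1,
        (inner ℝ (θ : EuclideanSpace ℝ (Fin d)) v) ^ 2 ∂μ := by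
  obtain ⟨θ₁, -⟩ := exists_sphere_smul_eq hd (0 : EuclideanSpace ℝ (Fin d))
  obtain ⟨v₀, hv₀, hmin⟩ := (isCompact_sphere (0 : EuclideanSpace ℝ (Fin d)) 1).exists_isMinOn
    ⟨θ₁, θ₁.2⟩ (continuous_integral_inner_sq μ).continuousOn
  refine ⟨_, integral_inner_sq_pos μ hμ (v := v₀) ?_, fun v => ?_⟩
  · rintro rfl
    simp at hv₀
  · obtain ⟨θ, hθ⟩ := exists_sphere_smul_eq hd v
    have h1 := hmin θ.2
    simp only [Set.mem_ofPred_eq] at h1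
    calc _ ≤ (∫ η : Metric.sphere (0 : EuclideanSpace ℝ (Fin d)) 1,
          (inner ℝ (η : EuclideanSpace ℝ (Fin d)) (θ : EuclideanSpace ℝ (Fin d))) ^ 2 ∂μ) * ‖v‖ ^ 2 := by
            gcongr
      _ = _ := by
        rw [← integral_mul_const]
        congr 1 with η
        conv_rhs => rw [hθ, inner_smul_right]
        ring

theorem setIntegral_rpow_mul_indicator_Iio {p δ : ℝ} (hp : α < p) (hδ : 0 ≤ δ) :
    ∫ s in Set.Ioi 0, s ^ (-1 - α) * (Set.Iio δ).indicator (fun s => s ^ p) s =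
      δ ^ (p - α) / (p - α) := by
  have e : (fun s : ℝ => s ^ (-1 - α) * (Set.Iio δ).indicator (fun s => s ^ p) s) =
      (Set.Iio δ).indicator (fun s => s ^ (-1 - α) * s ^ p) := by
    ext s; by_cases hs : s ∈ Set.Iio δ <;> simp [hs]
  have e2 : ∀ s ∈ Set.Ioo 0 δ, s ^ (-1 - α) * s ^ p = s ^ (p - α - 1) := fun s hs => by
    rw [← Real.rpow_add hs.1]; ring_nf
  rw [e, setIntegral_indicator measurableSet_Iio, Set.Ioi_inter_Iio,
    setIntegral_congr_fun measurableSet_Ioo e2, ← integral_Ioc_eq_integral_Ioo,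
    ← intervalIntegral.integral_of_le hδ, integral_rpow (Or.inl (by linarith)), sub_add_cancel,
    Real.zero_rpow (by linarith), sub_zero]

theorem compensatedExp_re {V : Type*} [NormedAddCommGroup V] [InnerProductSpace ℝ V] (y v : V) :
    (compensatedExp y v).re = Real.cos (-(2 * Real.pi) * inner ℝ y v) - 1 := by
  simp only [compensatedExp, Complex.sub_re, Complex.one_re, mul_comm Complex.I,
    Complex.exp_ofReal_mul_I_re, Complex.re_ofReal_mul, Complex.I_re, mul_zero, sub_zero]

theorem compensatedExp_re_nonpos {V : Type*} [NormedAddCommGroup V] [InnerProductSpace ℝ V]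
    (y v : V) : (compensatedExp y v).re ≤ 0 := by
  rw [compensatedExp_re]
  linarith [Real.cos_le_one (-(2 * Real.pi) * inner ℝ y v)]

theorem compensatedExp_re_le {V : Type*} [NormedAddCommGroup V] [InnerProductSpace ℝ V] (y v : V)
    (h : 2 * Real.pi * (‖y‖ * ‖v‖) ≤ 1) :
    (compensatedExp y v).re ≤ -(8 * (inner ℝ y v) ^ 2) := by
  rw [compensatedExp_re]
  have h1 := Real.cos_le_one_sub_mul_cos_sq (x := -(2 * Real.pi) * inner ℝ y v)
    ((abs_two_pi_mul_inner_le y v).trans (h.trans (by linarith [Real.pi_gt_three])))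
  have h2 : 2 / Real.pi ^ 2 * (-(2 * Real.pi) * inner ℝ y v) ^ 2 = 8 * (inner ℝ y v) ^ 2 := by
    field_simp
    ring
  linarith

/-- The real part of the integrand is `cos - 1 ≤ 0`. When `2π|v| > 1` only `|y| < δ = (2π|v|)⁻¹` is
kept, where it is at most `-8⟨y,v⟩²`. The radial integral gives `δ^(2-α)/(2-α)`, the spherical one
at least `8c₀|v|²`, and their product is `c|v|^α`. For the remaining `v` the additive `c` makes the
bound nonnegative. -/
theorem exists_re_integral_compensatedExp_le (hα0 : 0 < α) (hα2 : α < 2) (hd : 0 < d)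
    (hμ : IsNondegenerate (μ.map Subtype.val)) :
    ∃ c, 0 < c ∧ ∀ v : EuclideanSpace ℝ (Fin d),
      (∫ y in Metric.ball 0 1, compensatedExp y v ∂(stableLevyMeasure α μ)).re
        ≤ c - c * ‖v‖ ^ α := by
  obtain ⟨c₀, hc₀, hc₀'⟩ := exists_le_integral_inner_sq μ hd hμ
  have h2 := integrableOn_sq_norm_stableLevyMeasure μ hα2
  have hre : ∀ v : EuclideanSpace ℝ (Fin d),
      (∫ y in Metric.ball 0 1, compensatedExp y v ∂(stableLevyMeasure α μ)).re =
      ∫ y in Metric.ball 0 1, (compensatedExp y v).re ∂(stableLevyMeasure α μ) :=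
    fun v => (integral_re (integrable_compensatedExp _ h2 v)).symm
  refine ⟨8 * c₀ * (2 * Real.pi) ^ (α - 2) / (2 - α), ?_, fun v => ?_⟩
  · have : 0 < 2 - α := by linarith
    positivity
  set c := 8 * c₀ * (2 * Real.pi) ^ (α - 2) / (2 - α) with hc
  have hcpos : 0 < c := by
    have : 0 < 2 - α := by linarith
    positivity
  rw [hre]
  rcases le_or_gt (2 * Real.pi * ‖v‖) 1 with hv | hv
  · have h1 : ∫ y in Metric.ball 0 1, (compensatedExp y v).re ∂(stableLevyMeasure α μ) ≤ 0 :=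
      integral_nonpos fun y => compensatedExp_re_nonpos y v
    have h3 : ‖v‖ ≤ 1 := by nlinarith [Real.pi_gt_three, norm_nonneg v]
    have h4 : ‖v‖ ^ α ≤ 1 := Real.rpow_le_one (norm_nonneg _) h3 hα0.le
    nlinarith
  · have hvpos : 0 < ‖v‖ := by
      by_contra h
      have : ‖v‖ = 0 := le_antisymm (not_lt.1 h) (norm_nonneg _)
      rw [this] at hv
      norm_num at hv
    set δ := (2 * Real.pi * ‖v‖)⁻¹ with hδ
    have hδ0 : 0 < δ := by positivity
    have hδ1 : δ ≤ 1 := inv_le_one_of_one_le₀ hv.le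
    set ψ : EuclideanSpace ℝ (Fin d) → ℝ :=
      (Metric.ball 0 δ).indicator fun y => 8 * (inner ℝ y v) ^ 2 with hψ
    have hψm : Measurable ψ := Measurable.indicator (by fun_prop) measurableSet_ball
    have hψi : IntegrableOn ψ (Metric.ball 0 1) (stableLevyMeasure α μ) := by
      refine (h2.const_mul (8 * ‖v‖ ^ 2)).mono' hψm.aestronglyMeasurable (.of_forall fun y => ?_)
      refine (norm_indicator_le_norm_self _ _).trans ?_
      rw [Real.norm_of_nonneg (by positivity), mul_assoc, ← mul_pow, ← sq_abs (inner ℝ y v)]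
      gcongr
      rw [mul_comm]
      exact abs_real_inner_le_norm y v
    have h5 : ∫ y in Metric.ball 0 1, (compensatedExp y v).re ∂(stableLevyMeasure α μ) ≤
        ∫ y in Metric.ball 0 1, -ψ y ∂(stableLevyMeasure α μ) := by
      refine integral_mono (integrable_compensatedExp _ h2 v).re hψi.neg fun y => ?_
      by_cases hy : y ∈ Metric.ball (0 : EuclideanSpace ℝ (Fin d)) δ
      · simp only [hψ, Set.indicator_of_mem hy]
        refine compensatedExp_re_le y v ?_
        rw [mem_ball_zero_iff, hδ] at hy
        calc 2 * Real.pi * (‖y‖ * ‖v‖) = ‖y‖ * (2 * Real.pi * ‖v‖) := by ring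
          _ ≤ (2 * Real.pi * ‖v‖)⁻¹ * (2 * Real.pi * ‖v‖) := by gcongr
          _ = 1 := inv_mul_cancel₀ (by positivity)
      · simp only [hψ, Set.indicator_of_notMem hy, neg_zero]
        exact compensatedExp_re_nonpos y v
    have h6 : ∫ y in Metric.ball 0 1, ψ y ∂(stableLevyMeasure α μ) =
        ∫ y, ψ y ∂(stableLevyMeasure α μ) := by
      refine setIntegral_eq_integral_of_forall_compl_eq_zero fun y hy => ?_
      exact Set.indicator_of_notMem (fun h => hy (Metric.ball_subset_ball hδ1 h)) _
    have h7 := integral_stableLevyMeasure α μ (F := ψ) hψm.aestronglyMeasurable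
      ((Set.Iio δ).indicator fun s => s ^ (2 : ℝ))
      (fun θ => 8 * (inner ℝ (θ : EuclideanSpace ℝ (Fin d)) v) ^ 2) (fun s hs θ => by
        by_cases h : s < δ
        · rw [hψ, Set.indicator_of_mem (by simpa [norm_smul_sphere hs] using h),
            Set.indicator_of_mem (by exact h), real_inner_smul_left, smul_eq_mul, Real.rpow_two]
          ring
        · rw [hψ, Set.indicator_of_notMem (by simpa [norm_smul_sphere hs] using h),
            Set.indicator_of_notMem (by exact h), zero_smul])
    rw [setIntegral_rpow_mul_indicator_Iio hα2 hδ0.le, integral_const_mul, smul_eq_mul] at h7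
    have h8 : c * ‖v‖ ^ α ≤ ∫ y, ψ y ∂(stableLevyMeasure α μ) := by
      have h2α : 0 < 2 - α := by linarith
      rw [h7]
      calc c * ‖v‖ ^ α = δ ^ (2 - α) / (2 - α) * (8 * (c₀ * ‖v‖ ^ 2)) := by
            have e : ‖v‖ ^ α = ‖v‖ ^ (α - 2) * ‖v‖ ^ 2 := by
              rw [← Real.rpow_two, ← Real.rpow_add hvpos, sub_add_cancel]
            rw [hc, hδ, Real.inv_rpow (by positivity), ← Real.rpow_neg (by positivity), neg_sub,
              Real.mul_rpow (by positivity) hvpos.le, e]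
            ring
        _ ≤ _ := by
            gcongr
            exact hc₀' v
    rw [integral_neg, h6] at h5
    linarith

end StableLevyMeasureEstimates

/-! ### Homogeneity of the characteristic exponent -/

section StableExponent

theorem map_mul_left_radialMeasure {r : ℝ} (hr : 0 < r) (α : ℝ) :
    (radialMeasure α).map (r * ·) = ENNReal.ofReal (r ^ α) • radialMeasure α := by
  ext A hA
  have hmr : Measurable fun s : ℝ => r * s := measurable_const_mul r
  set w : ℝ → ℝ≥0∞ := fun s => ENNReal.ofReal (s ^ (-1 - α)) with hw
  have hwm : Measurable w := measurable_radialDensity α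
  set H : ℝ → ℝ≥0∞ := (Set.Ioi 0 ∩ A).indicator fun u => w (r⁻¹ * u) with hH
  have hHm : Measurable H :=
    (hwm.comp (measurable_const_mul r⁻¹)).indicator (measurableSet_Ioi.inter hA)
  have h1 : ∫⁻ s, H (r * s) = ENNReal.ofReal r⁻¹ * ∫⁻ u, H u := by
    rw [← lintegral_map hHm hmr, Real.map_volume_mul_left hr.ne', lintegral_smul_measure,
      abs_of_pos (inv_pos.2 hr), smul_eq_mul]
  have h2 : radialMeasure α ((r * ·) ⁻¹' A) = ∫⁻ s, H (r * s) := by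
    rw [radialMeasure, withDensity_apply _ (hmr hA), Measure.restrict_restrict (hmr hA),
      ← lintegral_indicator ((hmr hA).inter measurableSet_Ioi)]
    refine lintegral_congr fun s => ?_
    by_cases hs : s ∈ (r * ·) ⁻¹' A ∩ Set.Ioi 0
    · have hs' : r * s ∈ Set.Ioi 0 ∩ A := ⟨mul_pos hr hs.2, hs.1⟩
      rw [Set.indicator_of_mem hs, hH, Set.indicator_of_mem hs', hw]
      simp only [inv_mul_cancel_left₀ hr.ne']
    · have hs' : r * s ∉ Set.Ioi 0 ∩ A := fun h => hs ⟨h.2, (mul_pos_iff_of_pos_left hr).1 h.1⟩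
      rw [Set.indicator_of_notMem hs, hH, Set.indicator_of_notMem hs']
  have h3 : ∫⁻ u, H u = ENNReal.ofReal (r ^ (1 + α)) * radialMeasure α A := by
    rw [radialMeasure, withDensity_apply _ hA, Measure.restrict_restrict hA,
      ← lintegral_const_mul _ hwm, Set.inter_comm, ← lintegral_indicator (measurableSet_Ioi.inter hA)]
    refine lintegral_congr fun u => ?_
    by_cases hu : u ∈ Set.Ioi 0 ∩ A
    · rw [hH, Set.indicator_of_mem hu, Set.indicator_of_mem hu, hw]
      simp only
      rw [← ENNReal.ofReal_mul (by positivity), Real.mul_rpow (by positivity) (le_of_lt hu.1),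
        Real.inv_rpow hr.le, ← Real.rpow_neg hr.le]
      ring_nf
    · rw [hH, Set.indicator_of_notMem hu, Set.indicator_of_notMem hu]
  rw [Measure.map_apply hmr hA, h2, h1, h3, ← mul_assoc, ← ENNReal.ofReal_mul (by positivity),
    Measure.smul_apply, smul_eq_mul, Real.rpow_add hr, Real.rpow_one, inv_mul_cancel_left₀ hr.ne']

variable {d : ℕ} {α : ℝ} (μ : Measure (Metric.sphere (0 : EuclideanSpace ℝ (Fin d)) 1))
  [IsFiniteMeasure μ]

theorem map_smul_stableLevyMeasure {r : ℝ} (hr : 0 < r) :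
    (stableLevyMeasure α μ).map (r • ·) = ENNReal.ofReal (r ^ α) • stableLevyMeasure α μ := by
  have hmr : Measurable fun s : ℝ => r * s := measurable_const_mul r
  rw [stableLevyMeasure_eq_map, Measure.map_map (measurable_const_smul r) measurable_smul_sphere]
  have e : ((fun x : EuclideanSpace ℝ (Fin d) => r • x) ∘
      fun z : ℝ × Metric.sphere (0 : EuclideanSpace ℝ (Fin d)) 1 =>
        z.1 • (z.2 : EuclideanSpace ℝ (Fin d))) =
      (fun z : ℝ × Metric.sphere (0 : EuclideanSpace ℝ (Fin d)) 1 =>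
        z.1 • (z.2 : EuclideanSpace ℝ (Fin d))) ∘
        (Prod.map (r * ·) id : ℝ × Metric.sphere (0 : EuclideanSpace ℝ (Fin d)) 1 → _) := by
    ext1 z
    simp [smul_smul]
  rw [e, ← Measure.map_map measurable_smul_sphere (hmr.prodMap measurable_id),
    ← Measure.map_prod_map _ _ hmr measurable_id, map_mul_left_radialMeasure hr, Measure.map_id,
    Measure.prod_smul_left, Measure.map_smul]

/-- The integrand of `levyExponent`. -/
noncomputable def levyIntegrand (ξ y : EuclideanSpace ℝ (Fin d)) : ℂ :=
  Complex.exp (Complex.I * (inner ℝ ξ y : ℝ)) - 1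
    - (Metric.ball (0 : EuclideanSpace ℝ (Fin d)) 1).indicator
        (fun y => Complex.I * ((inner ℝ ξ y : ℝ) : ℂ)) y

theorem measurable_levyIntegrand (ξ : EuclideanSpace ℝ (Fin d)) :
    Measurable (levyIntegrand ξ) := by
  refine Measurable.sub (by fun_prop) (Measurable.indicator (by fun_prop) measurableSet_ball)

theorem levyIntegrand_of_mem {y : EuclideanSpace ℝ (Fin d)} (hy : y ∈ Metric.ball 0 1)
    (v : EuclideanSpace ℝ (Fin d)) :
    levyIntegrand (-(2 * Real.pi) • v) y = compensatedExp y v := by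
  rw [levyIntegrand, Set.indicator_of_mem hy, compensatedExp, real_inner_smul_left,
    real_inner_comm y v]

theorem levyIntegrand_of_notMem {y : EuclideanSpace ℝ (Fin d)} (hy : y ∉ Metric.ball 0 1)
    (ξ : EuclideanSpace ℝ (Fin d)) :
    levyIntegrand ξ y = Complex.exp ((inner ℝ y ξ : ℝ) * Complex.I) - 1 := by
  rw [levyIntegrand, Set.indicator_of_notMem hy, sub_zero, mul_comm, real_inner_comm]

theorem integrable_cexp_inner (m : Measure (EuclideanSpace ℝ (Fin d))) [IsFiniteMeasure m]
    (ξ : EuclideanSpace ℝ (Fin d)) :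
    Integrable (fun y => Complex.exp ((inner ℝ y ξ : ℝ) * Complex.I)) m :=
  (integrable_const (1 : ℝ)).mono' (by fun_prop) (.of_forall fun y => by
    rw [Complex.norm_exp_ofReal_mul_I])

theorem isFiniteMeasure_restrict_compl_ball (hα0 : 0 < α) :
    IsFiniteMeasure ((stableLevyMeasure α μ).restrict (Metric.ball 0 1)ᶜ) :=
  isFiniteMeasure_restrict.2 (stableLevyMeasure_compl_ball_lt_top μ hα0).ne

theorem integrableOn_ball_levyIntegrand (hα2 : α < 2) (v : EuclideanSpace ℝ (Fin d)) :
    IntegrableOn (levyIntegrand (-(2 * Real.pi) • v)) (Metric.ball 0 1) (stableLevyMeasure α μ) :=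
  IntegrableOn.congr_fun (integrable_compensatedExp _ (integrableOn_sq_norm_stableLevyMeasure μ hα2) v)
    (fun _ hy => (levyIntegrand_of_mem hy v).symm) measurableSet_ball

theorem integrableOn_compl_ball_levyIntegrand (hα0 : 0 < α) (ξ : EuclideanSpace ℝ (Fin d)) :
    IntegrableOn (levyIntegrand ξ) (Metric.ball 0 1)ᶜ (stableLevyMeasure α μ) := by
  have := isFiniteMeasure_restrict_compl_ball μ hα0
  exact IntegrableOn.congr_fun ((integrable_cexp_inner _ ξ).sub (integrable_const 1))
    (fun _ hy => (levyIntegrand_of_notMem hy ξ).symm) measurableSet_ball.compl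

theorem integrable_levyIntegrand (hα0 : 0 < α) (hα2 : α < 2) (ξ : EuclideanSpace ℝ (Fin d)) :
    Integrable (levyIntegrand ξ) (stableLevyMeasure α μ) := by
  obtain ⟨v, rfl⟩ : ∃ v, ξ = -(2 * Real.pi) • v := ⟨(-(2 * Real.pi))⁻¹ • ξ, by
    rw [smul_inv_smul₀ (neg_ne_zero.2 Real.two_pi_pos.ne')]⟩
  rw [← integrableOn_univ, ← Set.union_compl_self (Metric.ball (0 : EuclideanSpace ℝ (Fin d)) 1)]
  exact (integrableOn_ball_levyIntegrand μ hα2 v).union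
    (integrableOn_compl_ball_levyIntegrand μ hα0 _)

theorem integral_levyIntegrand (hα0 : 0 < α) (hα2 : α < 2) (v : EuclideanSpace ℝ (Fin d)) :
    ∫ y, levyIntegrand (-(2 * Real.pi) • v) y ∂(stableLevyMeasure α μ) =
      (∫ y in Metric.ball 0 1, compensatedExp y v ∂(stableLevyMeasure α μ)) +
      (charFun ((stableLevyMeasure α μ).restrict (Metric.ball 0 1)ᶜ) (-(2 * Real.pi) • v)
        - (stableLevyMeasure α μ).real (Metric.ball 0 1)ᶜ) := by
  have := isFiniteMeasure_restrict_compl_ball μ hα0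
  rw [← integral_add_compl measurableSet_ball (integrable_levyIntegrand μ hα0 hα2 _),
    setIntegral_congr_fun measurableSet_ball (fun y hy => levyIntegrand_of_mem hy v),
    setIntegral_congr_fun measurableSet_ball.compl (fun y hy => levyIntegrand_of_notMem hy _),
    integral_sub (integrable_cexp_inner _ _) (integrable_const 1), charFun_apply]
  simp [Measure.real]

theorem integrable_sphere_coe :
    Integrable (fun θ : Metric.sphere (0 : EuclideanSpace ℝ (Fin d)) 1 =>
      (θ : EuclideanSpace ℝ (Fin d))) μ :=
  continuous_subtype_val.integrable_of_hasCompactSupport (HasCompactSupport.of_compactSpace _)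

/-- The two definitions of the drift agree formally: `∫_0^1 s^(-α) ds` for `α < 1` and `-∫_1^∞
s^(-α) ds` for `α > 1` both equal `1/(1-α)`. -/
theorem stableDrift_eq (hα : α ≠ 1) :
    stableDrift α μ = (1 - α)⁻¹ • ∫ θ, (θ : EuclideanSpace ℝ (Fin d)) ∂μ := by
  rw [stableDrift]
  split_ifs with h1
  · have hm : MeasurableSet {y : EuclideanSpace ℝ (Fin d) | ‖y‖ < 1} :=
      measurableSet_lt measurable_norm measurable_const
    rw [← integral_indicator hm, integral_stableLevyMeasure α μ
      (measurable_id'.indicator hm).aestronglyMeasurable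
      ((Set.Iio 1).indicator fun s => s ^ (1 : ℝ)) (fun θ => (θ : EuclideanSpace ℝ (Fin d))) ?_,
      setIntegral_rpow_mul_indicator_Iio h1 zero_le_one, Real.one_rpow, one_div]
    intro s hs θ
    by_cases h : s < 1
    · rw [Set.indicator_of_mem (by change ‖_‖ < 1; rwa [norm_smul_sphere hs]),
        Set.indicator_of_mem (by exact h), Real.rpow_one]
    · rw [Set.indicator_of_notMem (by change ¬ ‖_‖ < 1; rwa [norm_smul_sphere hs]),
        Set.indicator_of_notMem (by exact h), zero_smul]
  · have h2 : 1 < α := lt_of_le_of_ne (not_lt.1 h1) hα.symm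
    have hm : MeasurableSet {y : EuclideanSpace ℝ (Fin d) | 1 < ‖y‖} :=
      measurableSet_lt measurable_const measurable_norm
    rw [← integral_indicator hm, integral_stableLevyMeasure α μ
      (measurable_id'.indicator hm).aestronglyMeasurable
      ((Set.Ioi 1).indicator fun s => s) (fun θ => (θ : EuclideanSpace ℝ (Fin d))) ?_]
    · have e : (fun s : ℝ => s ^ (-1 - α) * (Set.Ioi 1).indicator (fun s => s) s) =
          (Set.Ioi 1).indicator (fun s => s ^ (-1 - α) * s) := by
        ext s; by_cases hs : s ∈ Set.Ioi (1 : ℝ) <;> simp [hs]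
      have e2 : ∀ s ∈ Set.Ioi (1 : ℝ), s ^ (-1 - α) * s = s ^ (-α) := fun s hs => by
        rw [← Real.rpow_add_one (ne_of_gt (zero_lt_one.trans hs))]; ring_nf
      rw [e, setIntegral_indicator measurableSet_Ioi,
        Set.inter_eq_right.2 (Set.Ioi_subset_Ioi zero_le_one),
        setIntegral_congr_fun measurableSet_Ioi e2,
        integral_Ioi_rpow_of_lt (by linarith) zero_lt_one, Real.one_rpow, ← neg_smul]
      congr 1
      rw [neg_div, neg_neg, one_div]
      ring_nf
    · intro s hs θ
      by_cases h : 1 < s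
      · rw [Set.indicator_of_mem (by change 1 < ‖_‖; rwa [norm_smul_sphere hs]),
          Set.indicator_of_mem (by exact h)]
      · rw [Set.indicator_of_notMem (by change ¬ 1 < ‖_‖; rwa [norm_smul_sphere hs]),
          Set.indicator_of_notMem (by exact h), zero_smul]

theorem setIntegral_rpow_mul_annulus (hα : α ≠ 1) {r : ℝ} (hr : 1 ≤ r) :
    ∫ s in Set.Ioi 0, s ^ (-1 - α) * (-(Set.Ico r⁻¹ 1).indicator (fun s => s) s) =
      (r ^ (α - 1) - 1) / (1 - α) := by
  have hr0 : 0 < r⁻¹ := inv_pos.2 (zero_lt_one.trans_le hr)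
  have hr1 : r⁻¹ ≤ 1 := inv_le_one_of_one_le₀ hr
  have e : (fun s : ℝ => s ^ (-1 - α) * (-(Set.Ico r⁻¹ 1).indicator (fun s => s) s)) =
      fun s => -(Set.Ico r⁻¹ 1).indicator (fun s => s ^ (-1 - α) * s) s := by
    ext s; by_cases hs : s ∈ Set.Ico r⁻¹ 1 <;> simp [hs]
  have e2 : ∀ s ∈ Set.Ico r⁻¹ 1, s ^ (-1 - α) * s = s ^ (-α) := fun s hs => by
    rw [← Real.rpow_add_one (ne_of_gt (hr0.trans_le hs.1))]; ring_nf
  rw [e, integral_neg, setIntegral_indicator measurableSet_Ico,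
    Set.inter_eq_right.2 (show Set.Ico r⁻¹ 1 ⊆ Set.Ioi 0 from fun s hs => hr0.trans_le hs.1),
    setIntegral_congr_fun measurableSet_Ico e2,
    integral_Ico_eq_integral_Ioo, ← integral_Ioc_eq_integral_Ioo,
    ← intervalIntegral.integral_of_le hr1, integral_rpow (Or.inr ⟨fun h => hα (by linarith), ?_⟩),
    Real.one_rpow, Real.inv_rpow (by positivity), ← Real.rpow_neg (by positivity), ← neg_div]
  · ring_nf
  · rw [Set.uIcc_of_le hr1]
    exact fun h => absurd h.1 (not_le.2 hr0)

/-- Rescaling `y ↦ ry` multiplies `ν` by `r^α` but moves the truncation radius from `1` to `1/r`.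
The mismatch is a linear term over the annulus `1/r ≤ |y| < 1`, and the drift is what compensates
it. -/
theorem levyExponent_smul_of_one_le (hα0 : 0 < α) (hα2 : α < 2)
    (hμ1 : α = 1 → (∫ θ, (θ : EuclideanSpace ℝ (Fin d)) ∂μ) = 0) {r : ℝ} (hr : 1 ≤ r)
    (ξ : EuclideanSpace ℝ (Fin d)) :
    levyExponent (stableLevyMeasure α μ) (stableDrift α μ) (r • ξ) =
      (r ^ α : ℝ) * levyExponent (stableLevyMeasure α μ) (stableDrift α μ) ξ := by
  have hr0 : 0 < r := zero_lt_one.trans_le hr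
  set ν := stableLevyMeasure α μ with hν
  set m := ∫ θ, (θ : EuclideanSpace ℝ (Fin d)) ∂μ with hm
  set J := ∫ s in Set.Ioi 0, s ^ (-1 - α) * (-(Set.Ico r⁻¹ 1).indicator (fun s => s) s) with hJ
  have hmap : ∫ y, levyIntegrand ξ (r • y) ∂ν = (r ^ α : ℝ) * ∫ y, levyIntegrand ξ y ∂ν := by
    rw [← integral_map (φ := fun y : EuclideanSpace ℝ (Fin d) => r • y)
      (measurable_const_smul r).aemeasurable (measurable_levyIntegrand ξ).aestronglyMeasurable,
      hν, map_smul_stableLevyMeasure μ hr0, integral_smul_measure,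
      ENNReal.toReal_ofReal (by positivity), Complex.real_smul]
  have hi1 : Integrable (fun y => levyIntegrand ξ (r • y)) ν := by
    have h1 : Integrable (levyIntegrand ξ) (ν.map (r • ·)) := by
      rw [hν, map_smul_stableLevyMeasure μ hr0]
      exact (integrable_levyIntegrand μ hα0 hα2 ξ).smul_measure ENNReal.ofReal_ne_top
    exact h1.comp_measurable (measurable_const_smul r)
  have hi2 := integrable_levyIntegrand μ hα0 hα2 (r • ξ)
  have hdiff : ∫ y, (levyIntegrand (r • ξ) y - levyIntegrand ξ (r • y)) ∂ν =
      J * (Complex.I * r * (inner ℝ ξ m : ℝ)) := by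
    have hG : Measurable fun y => levyIntegrand (r • ξ) y - levyIntegrand ξ (r • y) :=
      (measurable_levyIntegrand (r • ξ)).sub
        ((measurable_levyIntegrand ξ).comp (measurable_const_smul r))
    rw [hν, integral_stableLevyMeasure α μ hG.aestronglyMeasurable
      (fun s => -(Set.Ico r⁻¹ 1).indicator (fun s => s) s)
      (fun θ => Complex.I * r * (inner ℝ ξ (θ : EuclideanSpace ℝ (Fin d)) : ℝ)) ?_]
    · rw [integral_const_mul, integral_complex_ofReal, integral_inner (integrable_sphere_coe μ),
        Complex.real_smul]
    · intro s hs θ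
      have e1 : r • s • (θ : EuclideanSpace ℝ (Fin d)) =
        (r * s) • (θ : EuclideanSpace ℝ (Fin d)) := smul_smul _ _ _
      have b1 : s • (θ : EuclideanSpace ℝ (Fin d)) ∈ Metric.ball 0 1 ↔ s < 1 := by
        rw [mem_ball_zero_iff, norm_smul_sphere hs]
      have b2 : (r * s) • (θ : EuclideanSpace ℝ (Fin d)) ∈ Metric.ball 0 1 ↔ s < r⁻¹ := by
        rw [mem_ball_zero_iff, norm_smul_sphere (mul_pos hr0 hs), lt_inv_comm₀ hs hr0,
          ← one_div, lt_div_iff₀ hs]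
      have b3 : s < r⁻¹ → s < 1 := fun h => h.trans_le (inv_le_one_of_one_le₀ hr)
      classical
      simp only [levyIntegrand, e1, Set.indicator_apply, b1, b2, Set.mem_Ico, real_inner_smul_left,
        real_inner_smul_right, Complex.real_smul]
      by_cases h2 : s < r⁻¹
      · simp only [h2, b3 h2, if_true, not_le.2 h2, false_and, if_false]
        push_cast
        ring_nf
      · by_cases h1 : s < 1
        · simp only [h2, h1, if_true, not_lt.1 h2, true_and, if_false]
          push_cast
          ring_nf
        · simp only [h2, h1, and_false, if_false]
          push_cast
          ring_nf
  have hint : ∫ y, levyIntegrand (r • ξ) y ∂ν = (r ^ α : ℝ) * ∫ y, levyIntegrand ξ y ∂ν +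
      J * (Complex.I * r * (inner ℝ ξ m : ℝ)) := by
    rw [integral_sub hi2 hi1, hmap] at hdiff
    linear_combination hdiff
  -- For `α ≠ 1` this is `r(r^(α-1) - 1)/(1-α) + r/(1-α) = r^α/(1-α)`. For `α = 1` the drift is zero
  -- and the centring of `μ` removes the annulus term.
  have hb : J * r * inner ℝ ξ m + r * inner ℝ ξ (stableDrift α μ) =
      r ^ α * inner ℝ ξ (stableDrift α μ) := by
    by_cases hα : α = 1
    · have hd : stableDrift α μ = 0 := by simp [stableDrift, hα]
      rw [hμ1 hα, hd]
      simp
    · have h1α : 1 - α ≠ 0 := fun h => hα (by linarith)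
      rw [stableDrift_eq μ hα, hJ, setIntegral_rpow_mul_annulus hα hr, ← hm, inner_smul_right,
        Real.rpow_sub_one hr0.ne']
      field_simp
      ring
  have hb' := congrArg (fun x : ℝ => (x : ℂ)) hb
  simp only [Complex.ofReal_add, Complex.ofReal_mul] at hb'
  change -(∫ y, levyIntegrand (r • ξ) y ∂ν) - Complex.I * (inner ℝ (r • ξ) (stableDrift α μ) : ℝ) =
    (r ^ α : ℝ) * (-(∫ y, levyIntegrand ξ y ∂ν) - Complex.I * (inner ℝ ξ (stableDrift α μ) : ℝ))
  rw [hint, real_inner_smul_left, Complex.ofReal_mul]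
  linear_combination (-Complex.I) * hb'

theorem levyExponent_smul (hα0 : 0 < α) (hα2 : α < 2)
    (hμ1 : α = 1 → (∫ θ, (θ : EuclideanSpace ℝ (Fin d)) ∂μ) = 0) {r : ℝ} (hr : 0 < r)
    (ξ : EuclideanSpace ℝ (Fin d)) :
    levyExponent (stableLevyMeasure α μ) (stableDrift α μ) (r • ξ) =
      (r ^ α : ℝ) * levyExponent (stableLevyMeasure α μ) (stableDrift α μ) ξ := by
  rcases le_total 1 r with h | h
  · exact levyExponent_smul_of_one_le μ hα0 hα2 hμ1 h ξ
  · have h1 := levyExponent_smul_of_one_le μ hα0 hα2 hμ1 ((one_le_inv₀ hr).2 h) (r • ξ)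
    rw [inv_smul_smul₀ hr.ne'] at h1
    rw [h1, ← mul_assoc, ← Complex.ofReal_mul, ← Real.mul_rpow hr.le (by positivity),
      mul_inv_cancel₀ hr.ne', Real.one_rpow, Complex.ofReal_one, one_mul]

end StableExponent

/-! ### The density at time one -/

section StableDensity

theorem fourierInv_comp_smul {V : Type*} [NormedAddCommGroup V] [InnerProductSpace ℝ V]
    [FiniteDimensional ℝ V] [MeasurableSpace V] [BorelSpace V] (F : V → ℂ) {r : ℝ} (hr : 0 < r)
    (x : V) : 𝓕⁻ (fun v => F (r • v)) x = ((r ^ Module.finrank ℝ V)⁻¹ : ℝ) * 𝓕⁻ F (r⁻¹ • x) := by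
  rw [Real.fourierInv_eq, Real.fourierInv_eq, ← Complex.real_smul]
  have h := Measure.integral_comp_smul (volume : Measure V)
    (fun v => Real.fourierChar (inner ℝ v (r⁻¹ • x)) • F v) r
  rw [abs_of_pos (by positivity)] at h
  rw [← h]
  congr 1 with v
  rw [inner_smul_left, inner_smul_right, RCLike.conj_to_real, mul_inv_cancel_left₀ hr.ne']

variable {d : ℕ} {α γ : ℝ} (μ : Measure (Metric.sphere (0 : EuclideanSpace ℝ (Fin d)) 1))

theorem ae_norm_le_one_restrict_ball :
    ∀ᵐ y ∂((stableLevyMeasure α μ).restrict (Metric.ball 0 1)), ‖y‖ ≤ 1 :=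
  (ae_restrict_mem measurableSet_ball).mono fun _ hy => (mem_ball_zero_iff.1 hy).le

variable [IsFiniteMeasure μ]

/-- The exponent of the part of a stable law with jumps in the unit ball, in the variable
`-2πv`. -/
noncomputable def smallJumpExponent (α : ℝ) (b v : EuclideanSpace ℝ (Fin d)) : ℂ :=
  (∫ y in Metric.ball 0 1, compensatedExp y v ∂(stableLevyMeasure α μ)) +
    ((Complex.I * (-(2 * Real.pi) : ℝ)) • innerCLM b) v

theorem neg_levyExponent_eq (hα0 : 0 < α) (hα2 : α < 2) (b v : EuclideanSpace ℝ (Fin d)) :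
    -levyExponent (stableLevyMeasure α μ) b (-(2 * Real.pi) • v) =
      smallJumpExponent μ α b v +
      (charFun ((stableLevyMeasure α μ).restrict (Metric.ball 0 1)ᶜ) (-(2 * Real.pi) • v)
        - (stableLevyMeasure α μ).real (Metric.ball 0 1)ᶜ) := by
  change -(-(∫ y, levyIntegrand (-(2 * Real.pi) • v) y ∂(stableLevyMeasure α μ)) -
    Complex.I * (inner ℝ (-(2 * Real.pi) • v) b : ℝ)) = _
  rw [integral_levyIntegrand μ hα0 hα2, smallJumpExponent, real_inner_smul_left,
    smul_apply, innerCLM_apply, real_inner_comm, smul_eq_mul, Complex.ofReal_mul]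
  ring

theorem contDiff_smallJumpExponent (hα2 : α < 2) (b : EuclideanSpace ℝ (Fin d)) :
    ContDiff ℝ ∞ (smallJumpExponent μ α b) :=
  (contDiff_integral_compensatedExp (integrableOn_sq_norm_stableLevyMeasure μ hα2)
    (ae_norm_le_one_restrict_ball μ)).add (ContinuousLinearMap.contDiff _)

theorem exists_smallJumpExponent_re_le (hα0 : 0 < α) (hα2 : α < 2) (hd : 0 < d)
    (hμ : IsNondegenerate (μ.map Subtype.val)) (b : EuclideanSpace ℝ (Fin d)) :
    ∃ c, 0 < c ∧ ∀ v, (smallJumpExponent μ α b v).re ≤ c - c * ‖v‖ ^ α := by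
  obtain ⟨c, hc, h⟩ := exists_re_integral_compensatedExp_le μ hα0 hα2 hd hμ
  refine ⟨c, hc, fun v => le_trans (le_of_eq ?_) (h v)⟩
  simp [smallJumpExponent, innerCLM_apply]

theorem cexp_neg_levyExponent_eq (hα0 : 0 < α) (hα2 : α < 2) (b : EuclideanSpace ℝ (Fin d)) :
    (fun v => Complex.exp (-levyExponent (stableLevyMeasure α μ) b (-(2 * Real.pi) • v))) =
      fun v => Complex.exp (-(stableLevyMeasure α μ).real (Metric.ball 0 1)ᶜ) *
        (Complex.exp (smallJumpExponent μ α b v) * Complex.exp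
        (charFun ((stableLevyMeasure α μ).restrict (Metric.ball 0 1)ᶜ) (-(2 * Real.pi) • v))) := by
  ext1 v
  rw [neg_levyExponent_eq μ hα0 hα2, ← Complex.exp_add, ← Complex.exp_add]
  ring_nf

theorem integrable_cexp_neg_levyExponent (hα0 : 0 < α) (hα2 : α < 2) (hd : 0 < d)
    (hμ : IsNondegenerate (μ.map Subtype.val)) (b : EuclideanSpace ℝ (Fin d)) :
    Integrable fun v =>
      Complex.exp (-levyExponent (stableLevyMeasure α μ) b (-(2 * Real.pi) • v)) := by
  obtain ⟨c, hc, hre⟩ := exists_smallJumpExponent_re_le μ hα0 hα2 hd hμ b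
  have := isFiniteMeasure_restrict_compl_ball μ hα0
  rw [cexp_neg_levyExponent_eq μ hα0 hα2]
  refine Integrable.const_mul ?_ _
  refine (integrable_cexp_of_re_le (contDiff_smallJumpExponent μ hα2 b) hc hα0 hre).mul_bdd
    (c := Real.exp (((stableLevyMeasure α μ).restrict (Metric.ball 0 1)ᶜ).real Set.univ)) ?_
    (.of_forall fun v => ?_)
  · exact (Complex.measurable_exp.comp (measurable_charFun.comp
      (measurable_const_smul (-(2 * Real.pi))))).aestronglyMeasurable
  · rw [Complex.norm_exp, Real.exp_le_exp]
    exact (Complex.re_le_norm _).trans (norm_charFun_le _)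

theorem exists_norm_fourierInv_cexp_neg_levyExponent_le (hα0 : 0 < α) (hα2 : α < 2)
    (hγ1 : 1 ≤ γ) (hγd : γ ≤ d) (hμ : IsNondegenerate (μ.map Subtype.val))
    (hμγ : IsSphereKappaMeasure μ (γ - 1)) (b : EuclideanSpace ℝ (Fin d)) :
    ∃ D, ∀ x, x ≠ 0 → ‖𝓕⁻ (fun v => Complex.exp
      (-levyExponent (stableLevyMeasure α μ) b (-(2 * Real.pi) • v))) x‖ ≤
      D * ‖x‖ ^ (-(γ + α)) := by
  have hd : 0 < d := by
    have : (0 : ℝ) < d := by linarith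
    exact_mod_cast this
  obtain ⟨c, hc, hre⟩ := exists_smallJumpExponent_re_le μ hα0 hα2 hd hμ b
  -- The order `d + 2` is at least `γ + 2`, as the tail integral requires, and at least `γ + α`, as
  -- the pointwise bound requires.
  obtain ⟨C, hC⟩ := exists_forall_norm_iteratedFDeriv_le
    (integrableOn_sq_norm_stableLevyMeasure μ hα2) (ae_norm_le_one_restrict_ball μ)
    ((Complex.I * (-(2 * Real.pi) : ℝ)) • innerCLM b) (d + 2)
  obtain ⟨A, hA, hA'⟩ := exists_norm_fourierInv_cexp_le (contDiff_smallJumpExponent μ hα2 b)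
    hc hα0 hC hre
  obtain ⟨C', hC'0, hC'⟩ := exists_stableLevyMeasure_ball_inter_le μ hα0 hd hμγ
  obtain ⟨D, hD0, hD⟩ := exists_lintegral_decay_stableLevyMeasure_le μ hC'0 hC'
    (N := d + 2) (by push_cast; linarith) hA hA'
  have := isFiniteMeasure_restrict_compl_ball μ hα0
  refine ⟨‖Complex.exp (-(stableLevyMeasure α μ).real (Metric.ball 0 1)ᶜ)‖ *
    ((A + D) * Real.exp (2 ^ (γ + α) *
      (1 + ((stableLevyMeasure α μ).restrict (Metric.ball 0 1)ᶜ).real Set.univ))),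
    fun x hx => ?_⟩
  have h1 := norm_fourierInv_mul_exp_charFun_le
    (fun v => Complex.exp (smallJumpExponent μ α b v))
    ((stableLevyMeasure α μ).restrict (Metric.ball 0 1)ᶜ)
    (integrable_cexp_of_re_le (contDiff_smallJumpExponent μ hα2 b) hc hα0 hre)
    (s := γ + α) (D := A + D) (by linarith) (fun x hx => ?_) (fun z R hR => ?_) x hx
  · have h2 : 𝓕⁻ (fun v => Complex.exp
        (-levyExponent (stableLevyMeasure α μ) b (-(2 * Real.pi) • v))) x =
        Complex.exp (-(stableLevyMeasure α μ).real (Metric.ball 0 1)ᶜ) *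
        𝓕⁻ (fun v => Complex.exp (smallJumpExponent μ α b v) * Complex.exp
        (charFun ((stableLevyMeasure α μ).restrict (Metric.ball 0 1)ᶜ) (-(2 * Real.pi) • v))) x := by
      rw [cexp_neg_levyExponent_eq μ hα0 hα2, Real.fourierInv_eq, Real.fourierInv_eq,
        ← integral_const_mul]
      congr 1 with v
      rw [mul_smul_comm]
    rw [h2, norm_mul]
    refine (mul_le_mul_of_nonneg_left h1 (norm_nonneg _)).trans (le_of_eq (mul_assoc _ _ _).symm)
  · have hxp : 0 < ‖x‖ := norm_pos_iff.2 hx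
    refine (hA' x).trans ?_
    have h3 : ‖x‖ ^ (γ + α) ≤ (1 + ‖x‖) ^ (d + 2) := by
      calc ‖x‖ ^ (γ + α) ≤ (1 + ‖x‖) ^ (γ + α) := by gcongr; linarith
        _ ≤ (1 + ‖x‖) ^ ((d + 2 : ℕ) : ℝ) := by
          refine Real.rpow_le_rpow_of_exponent_le (by linarith) ?_
          push_cast
          linarith
        _ = _ := Real.rpow_natCast _ _
    rw [Real.rpow_neg hxp.le]
    gcongr
    linarith
  · refine (lintegral_mono' (Measure.restrict_mono le_rfl Measure.restrict_le_self) le_rfl).trans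
      ((hD z R hR).trans (ENNReal.ofReal_le_ofReal ?_))
    gcongr
    linarith

end StableDensity

/-! ### Scaling to all times -/

theorem mainTheorem3 (d : ℕ) (α γ : ℝ) (hα0 : 0 < α) (hα2 : α < 2)
    (hγ1 : 1 ≤ γ) (hγd : γ ≤ d)
    (μ : Measure (Metric.sphere (0 : EuclideanSpace ℝ (Fin d)) 1)) [IsFiniteMeasure μ]
    (hμ : IsNondegenerate (μ.map Subtype.val))
    (hμγ : IsSphereKappaMeasure μ (γ - 1))
    (hμ1 : α = 1 → (∫ θ, (θ : EuclideanSpace ℝ (Fin d)) ∂μ) = 0) :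
    ∃ c : ℝ, 0 < c ∧
      ∀ P : ℝ≥0 → Measure (EuclideanSpace ℝ (Fin d)), IsStableSemigroup α μ P →
        ∀ t : ℝ≥0, 0 < t →
          ∃ p : EuclideanSpace ℝ (Fin d) → ℝ,
            Continuous p ∧ (∀ x, 0 ≤ p x) ∧
            P t = (volume : Measure (EuclideanSpace ℝ (Fin d))).withDensity
              (fun x => ENNReal.ofReal (p x)) ∧
            (∀ x, p x ≤ c * (t : ℝ) ^ (-(d : ℝ) / α)) ∧
            (∀ x, x ≠ 0 → p x ≤ c * (t : ℝ) ^ (-(d : ℝ) / α) *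
              min 1 ((t : ℝ) ^ (1 + γ / α) * ‖x‖ ^ (-γ - α))) := by
  have hd : 0 < d := by
    have : (0 : ℝ) < d := by linarith
    exact_mod_cast this
  set Ψ : EuclideanSpace ℝ (Fin d) → ℂ := fun v => Complex.exp
    (-levyExponent (stableLevyMeasure α μ) (stableDrift α μ) (-(2 * Real.pi) • v)) with hΨ
  have hΨi : Integrable Ψ := integrable_cexp_neg_levyExponent μ hα0 hα2 hd hμ _
  obtain ⟨D, hD⟩ := exists_norm_fourierInv_cexp_neg_levyExponent_le μ hα0 hα2 hγ1 hγd hμ hμγ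
    (stableDrift α μ)
  have hI : 0 ≤ ∫ v, ‖Ψ v‖ := integral_nonneg fun v => norm_nonneg _
  -- The integral serves the uniform bound and `|D|` the decay, as the sign of `D` is not recorded;
  -- the `1` keeps `c` positive. All of it is fixed before `P` and `t`.
  set c := (∫ v, ‖Ψ v‖) + |D| + 1 with hc
  have hc0 : 0 < c := by positivity
  refine ⟨c, hc0, fun P hP t ht => ?_⟩
  have htr : (0 : ℝ) < t := ht
  have := hP.isProbabilityMeasure t
  set r : ℝ := (t : ℝ) ^ (1 / α) with hr
  have hr0 : 0 < r := Real.rpow_pos_of_pos htr _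
  have hrα : r ^ α = t := by
    rw [hr, ← Real.rpow_mul htr.le, one_div, inv_mul_cancel₀ hα0.ne', Real.rpow_one]
  -- With `r = t^(1/α)`, homogeneity gives `tΦ(ξ) = Φ(rξ)`: the transform at time `t` is a dilation
  -- of the one at time one.
  have hcf : (fun v => charFun (P t) (-(2 * Real.pi) • v)) = fun v => Ψ (r • v) := by
    ext1 v
    rw [hP.charFun_eq, hΨ]
    simp only
    rw [smul_comm (-(2 * Real.pi)) r v, levyExponent_smul μ hα0 hα2 hμ1 hr0, hrα, neg_mul]
  have hint : Integrable fun v => charFun (P t) (-(2 * Real.pi) • v) := by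
    rw [hcf]
    exact hΨi.comp_smul hr0.ne'
  obtain ⟨hp0, hpd⟩ := eq_withDensity_fourierInv_charFun (P t) hint
  have hrd : (r ^ d)⁻¹ = (t : ℝ) ^ (-(d : ℝ) / α) := by
    rw [hr, ← Real.rpow_natCast, ← Real.rpow_mul htr.le, ← Real.rpow_neg htr.le]
    congr 1
    ring
  have htd : 0 ≤ (t : ℝ) ^ (-(d : ℝ) / α) := Real.rpow_nonneg htr.le _
  have hbound : ∀ x, (𝓕⁻ (fun v => charFun (P t) (-(2 * Real.pi) • v)) x).re ≤
      (t : ℝ) ^ (-(d : ℝ) / α) * ‖𝓕⁻ Ψ (r⁻¹ • x)‖ := by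
    intro x
    refine (Complex.re_le_norm _).trans (le_of_eq ?_)
    rw [hcf, fourierInv_comp_smul Ψ hr0, finrank_euclideanSpace_fin, hrd, norm_mul,
      Complex.norm_real, Real.norm_of_nonneg htd]
  have hb1 : ∀ x, (𝓕⁻ (fun v => charFun (P t) (-(2 * Real.pi) • v)) x).re ≤
      c * (t : ℝ) ^ (-(d : ℝ) / α) := by
    intro x
    refine (hbound x).trans ?_
    rw [mul_comm]
    gcongr
    exact (norm_fourierInv_le Ψ _).trans (by rw [hc]; linarith [abs_nonneg D])
  refine ⟨_, Complex.continuous_re.comp (continuous_fourierInv hint), hp0, hpd, hb1,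
    fun x hx => ?_⟩
  rw [mul_min_of_nonneg _ _ (by positivity), mul_one]
  refine le_min (hb1 x) ((hbound x).trans ?_)
  have hx' : r⁻¹ • x ≠ 0 := smul_ne_zero (inv_ne_zero hr0.ne') hx
  have hnorm : ‖r⁻¹ • x‖ ^ (-(γ + α)) = (t : ℝ) ^ (1 + γ / α) * ‖x‖ ^ (-γ - α) := by
    rw [norm_smul, norm_inv, Real.norm_of_nonneg hr0.le, Real.mul_rpow (by positivity)
      (norm_nonneg _), Real.inv_rpow hr0.le, Real.rpow_neg hr0.le, inv_inv, hr,
      ← Real.rpow_mul htr.le, neg_add']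
    congr 2
    field_simp
    ring
  rw [mul_comm c, mul_assoc]
  gcongr
  rw [← hnorm]
  refine (hD _ hx').trans ?_
  gcongr
  rw [hc]
  linarith [le_abs_self D]
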